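/- Let $G$ be a finite group and let $O=C_1\sqcup\dots\sqcup C_m$ be the union of an ordered list of distinct conjugacy classes of $G$ with $1\notin O$, such that the elements of $O$ generate $G$. Write $g^h=h^{-1}gh$ and $[a,b]=aba^{-1}b^{-1}$. *Admissible groups.* For $n,p\ge 0$ let $\mathbb F^{n+2p}$ be the free group on $\gamma_1,\dots,\gamma_n,\lambda_1,\mu_1,\dots,\lambda_p,\mu_p$, and for $0\le k\le p$ and $n\ge1$ put $\gamma_{n}^{(k)}=\gamma_n^{[\lambda_1,\mu_1]\cdots[\lambda_k,\mu_k]}$. Let $Br_{n,p}\subset \mathrm{Aut}(\mathbb F^{n+2p})$ be the subgroup generated by the following automorphisms: - $\sigma_i$ ($1\le i\le n-1$): $\gamma_i\mapsto\gamma_{i+1}$, $\gamma_{i+1}\mapsto\gamma_i^{\gamma_{i+1}}$, the other free generators are fixed; and, if $n\ge1$, for $1\le i\le p$: - $\xi_{i,\lambda}$: with $g=\gamma_n^{(i-1)}$ and $c=\lambda_i\mu_i^{-1}\lambda_i^{-1}g^{-1}$, $\ g\mapsto g^{c}$, $\lambda_i\mapsto g\lambda_i$, and all $\gamma_j$ $(j\ne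 n)$, $\lambda_j$ $(j\neq i)$, $\mu_j$ are fixed; - $\xi_{i,\mu}$: with $g=\gamma_n^{(i)}$ and $c=\mu_i\lambda_i^{-1}\mu_i^{-1}g$, $\ g\mapsto g^{c}$, $\mu_i\mapsto g^{-1}\mu_i$, and all $\gamma_j$ $(j\neq n)$, $\lambda_j$, $\mu_j$ $(j\ne i)$ are fixed; - $\zeta_i$: with $g=\gamma_n^{(i-1)}$ and $c=g^{[\lambda_i,\mu_i]}$, $\ g\mapsto c$, $\lambda_i\mapsto\lambda_i^{c}$, $\mu_i\mapsto\mu_i^{c}$, and all $\gamma_j$ $(j\neq n)$, $\lambda_j,\mu_j$ $(j\ne i)$ are fixed. A subgroup $H_{n,p}\subset\mathrm{Aut}(\mathbb F^{n+2p})$ is *admissible* if it contains $Br_{n,p}$; for every $h\in H_{n,p}$ there is a permutation $\sigma_h$ of $\{1,\dots,n\}$ such that $h(\gamma_i)$ is conjugate to $\gamma_{\sigma_h(i)}$ for all $i$; and every $h\in H_{n,p}$ fixes $\gamma_1\cdots\gamma_n[\lambda_1,\mu_1]\cdots[\lambda_p,\mu_p]$. (The groups $Br_{n,p}$ are admissible.)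 *Covering semigroups.* For a collection $\mathcal H=\{H_{n,p}\}_{n,p\ge0}$ of admissible groups let $\mathbb S_{\mathcal H\text{-equiv}}(G,O)$ be the semigroup with generators $x_g$ $(g\in O)$ and $y_{a,b}$ $(a,b\in G)$ and the following relations: $x_g\,y_{a,b}=y_{a,b}\,x_{g^{[a,b]}}$ for all $g\in O$, $a,b\in G$; and, for all $n,p\geq 0$ with $n+p\ge1$, all $h\in H_{n,p}$ and all homomorphisms $f:\mathbb F^{n+2p}\to G$ with $f(\gamma_1),\dots,f(\gamma_n)\in O$, $$x_{f(\gamma_1)}\cdots x_{f(\gamma_n)}\,y_{f(\lambda_1),f(\mu_1)}\cdots y_{f(\lambda_p),f(\mu_p)}=x_{f(h(\gamma_1))}\cdots x_{f(h(\gamma_n))}\,y_{f(h(\lambda_1)),f(h(\mu_1))}\cdots y_{f(h(\lambda_p)),f(h(\mu_p))}.$$ The *strong covering semigroup* $\mathbb S(G,O)$ is the one obtained for $H_{n,p}=Br_{n,p}$, and $r_{\mathcal H}:\mathbb S(G,O)\to\mathbb S_{\mathcal H\text{-equiv}}(G,O)$ denotes the natural epimorphism. If an element $s$ of one of these semigroups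 is written as a product of generators, its type $\tau(s)=(\tau_1(s),\dots,\tau_m(s))\in\mathbb Z_{\ge0}^m$, where $\tau_i(s)$ is the number of factors $x_g$ with $g\in C_i$, and the subgroup $G_s\subset G$ generated by all $g$, $a$, $b$ occurring in the factors $x_g$, $y_{a,b}$ do not depend on the chosen product. For $T=(t_1,\dots,t_m)\in\mathbb Z^m_{\ge0}$ let the superscript $G$ and the subscript $\ge T$ denote the subsemigroup of all $s$ with $G_s=G$ and $\tau_i(s)\ge t_i$ for $i=1,\dots,m$. **Claim.** There is $T\in\mathbb Z_{\ge0}^m$, depending only on $(G,O)$, such that for every collection $\mathcal H$ of admissible groups $r_{\mathcal H}$ restricts to an isomorphism of semigroups $$\mathbb S(G,O)^G_{\ge T}\;\longrightarrow\;\mathbb S_{\mathcal H\text{-equiv}}(G,O)^G_{\ge T}.$$ -/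

import Mathlib

namespace CoveringSemigroup

open scoped commutatorElement

/-- The index set of the standard free generators `γ₁, …, γₙ, λ₁, μ₁, …, λₚ, μₚ` of the free group
of rank `n + 2p` (indices start at `0`). -/
inductive FrameIndex (n p : ℕ) : Type
  | gam (j : Fin n)
  | lam (i : Fin p)
  | mu (i : Fin p)

/-- The free group `𝔽^{n+2p}`, with the fixed frame `γ₁, …, γₙ, λ₁, μ₁, …, λₚ, μₚ`. -/
abbrev Free (n p : ℕ) : Type := FreeGroup (FrameIndex n p)

section Frames

variable {n p : ℕ}

/-- The generator `γ_j`. -/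
def γ (j : Fin n) : Free n p := FreeGroup.of (FrameIndex.gam j)

/-- The generator `λ_i`. -/
def lam (i : Fin p) : Free n p := FreeGroup.of (FrameIndex.lam i)

/-- The generator `μ_i`. -/
def mu (i : Fin p) : Free n p := FreeGroup.of (FrameIndex.mu i)

/-- The product `[λ₁, μ₁] ⋯ [λ_k, μ_k]` of the first `k` commutators, `[a, b] = a b a⁻¹ b⁻¹`. -/
def handles (n p k : ℕ) : Free n p :=
  (((List.finRange p).take k).map fun i => ⁅(lam i : Free n p), mu i⁆).prod

/-- The boundary `γ₁ ⋯ γₙ [λ₁, μ₁] ⋯ [λₚ, μₚ]` of the fixed frame. -/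
def boundary (n p : ℕ) : Free n p :=
  (List.ofFn fun j : Fin n => (γ j : Free n p)).prod * handles n p p

/-- `slid l k` is what the generator `γ_l` (used for the last index `l`) becomes after it has been
moved to the right past the first `k` commutators by elementary frame changes, each of which
replaces `γ, λ, μ` by `λ, μ, [λ, μ]⁻¹ γ [λ, μ]`. The elements `γ₁, …, γ_{n-1}`, `λ_i`, `μ_i` stay
the same, so the frame with `γₙ` moved past `k` commutators is
`γ₁, …, γ_{n-1}, λ₁, μ₁, …, λ_k, μ_k, slid (last) k, λ_{k+1}, μ_{k+1}, …, λₚ, μₚ`. -/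
def slid (l : Fin n) (k : ℕ) : Free n p := (handles n p k)⁻¹ * γ l * handles n p k

/-- The automorphism `σ` attached to two consecutive indices `i`, `j = i + 1`:
`γ_i ↦ γ_{i+1}`, `γ_{i+1} ↦ γ_{i+1}⁻¹ γ_i γ_{i+1}`, everything else is fixed. -/
structure IsSigma (i j : Fin n) (h : MulAut (Free n p)) : Prop where
  succ : (i : ℕ) + 1 = j
  map_i : h (γ i) = γ j
  map_j : h (γ j) = (γ j)⁻¹ * γ i * γ j
  map_γ : ∀ k, k ≠ i → k ≠ j → h (γ k) = γ k
  map_lam : ∀ k, h (lam k) = lam k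
  map_mu : ∀ k, h (mu k) = mu k

/-- The automorphism `ξ_{i,λ}`. It is given in the frame in which the last `γ` (called `g` below)
stands immediately before `λ_i, μ_i`:
`λ_i ↦ g λ_i`, `g ↦ c⁻¹ g c` with `c = λ_i μ_i⁻¹ λ_i⁻¹ g⁻¹`, the rest of the frame is fixed. -/
structure IsXiLam (l : Fin n) (i : Fin p) (h : MulAut (Free n p)) : Prop where
  last : (l : ℕ) + 1 = n
  map_slid : h (slid l i) =
    (lam i * (mu i)⁻¹ * (lam i)⁻¹ * (slid l i)⁻¹)⁻¹ * slid l i *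
      (lam i * (mu i)⁻¹ * (lam i)⁻¹ * (slid l i)⁻¹)
  map_lam_self : h (lam i) = slid l i * lam i
  map_γ : ∀ k, k ≠ l → h (γ k) = γ k
  map_lam : ∀ k, k ≠ i → h (lam k) = lam k
  map_mu : ∀ k, h (mu k) = mu k

/-- The automorphism `ξ_{i,μ}`. It is given in the frame in which the last `γ` (called `g` below)
stands immediately after `λ_i, μ_i`:
`μ_i ↦ g⁻¹ μ_i`, `g ↦ c⁻¹ g c` with `c = μ_i λ_i⁻¹ μ_i⁻¹ g`, the rest of the frame is fixed. -/
structure IsXiMu (l : Fin n) (i : Fin p) (h : MulAut (Free n p)) : Prop where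
  last : (l : ℕ) + 1 = n
  map_slid : h (slid l (i + 1)) =
    (mu i * (lam i)⁻¹ * (mu i)⁻¹ * slid l (i + 1))⁻¹ * slid l (i + 1) *
      (mu i * (lam i)⁻¹ * (mu i)⁻¹ * slid l (i + 1))
  map_mu_self : h (mu i) = (slid l (i + 1))⁻¹ * mu i
  map_γ : ∀ k, k ≠ l → h (γ k) = γ k
  map_lam : ∀ k, h (lam k) = lam k
  map_mu : ∀ k, k ≠ i → h (mu k) = mu k

/-- The element `c = [λ_i, μ_i]⁻¹ g [λ_i, μ_i]`, with `g` the last `γ` in the frame in which it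
stands immediately before `λ_i, μ_i`. -/
def zetaElt (l : Fin n) (i : Fin p) : Free n p :=
  ⁅(lam i : Free n p), mu i⁆⁻¹ * slid l i * ⁅(lam i : Free n p), mu i⁆

/-- The automorphism `ζ_i`. It is given in the frame in which the last `γ` (called `g` below)
stands immediately before `λ_i, μ_i`: with `c = [λ_i, μ_i]⁻¹ g [λ_i, μ_i]`,
`g ↦ c`, `λ_i ↦ c⁻¹ λ_i c`, `μ_i ↦ c⁻¹ μ_i c`, the rest of the frame is fixed. -/
structure IsZeta (l : Fin n) (i : Fin p) (h : MulAut (Free n p)) : Prop where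
  last : (l : ℕ) + 1 = n
  map_slid : h (slid l i) = zetaElt l i
  map_lam_self : h (lam i) = (zetaElt l i)⁻¹ * lam i * zetaElt l i
  map_mu_self : h (mu i) = (zetaElt l i)⁻¹ * mu i * zetaElt l i
  map_γ : ∀ k, k ≠ l → h (γ k) = γ k
  map_lam : ∀ k, k ≠ i → h (lam k) = lam k
  map_mu : ∀ k, k ≠ i → h (mu k) = mu k

/-- The algebraic braid group `Br_{n,p}`, generated by all the `σ_i`, `ξ_{i,λ}`, `ξ_{i,μ}`,
`ζ_i`. -/
def braidGroup (n p : ℕ) : Subgroup (MulAut (Free n p)) :=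
  Subgroup.closure
    ({h | ∃ i j, IsSigma i j h} ∪ {h | ∃ l i, IsXiLam l i h} ∪ {h | ∃ l i, IsXiMu l i h} ∪
      {h | ∃ l i, IsZeta l i h})

/-- Admissible groups of automorphisms of `𝔽^{n+2p}`. -/
structure IsAdmissible (H : Subgroup (MulAut (Free n p))) : Prop where
  braid_le : braidGroup n p ≤ H
  conj : ∀ h ∈ H, ∃ σ : Equiv.Perm (Fin n), ∀ i, IsConj (h (γ i)) (γ (σ i))
  boundary_fixed : ∀ h ∈ H, h (boundary n p) = boundary n p

/-! Existence of the automorphisms `σ_i`, `ξ_{i,λ}`, `ξ_{i,μ}`, `ζ_i`. -/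

lemma handles_succ (i : Fin p) :
    handles n p (i + 1) = handles n p i * ⁅(lam i : Free n p), mu i⁆ := by
  unfold handles
  rw [List.take_succ_eq_append_getElem (by simp)]
  simp

lemma map_handles {α : Type*} [Group α] (f : Free n p →* α) (k : ℕ) :
    f (handles n p k) =
      (((List.finRange p).take k).map fun i => ⁅f (lam i), f (mu i)⁆).prod := by
  unfold handles
  rw [map_list_prod, List.map_map]
  congr 1
  refine List.map_congr_left fun i _ => ?_
  simp [map_commutatorElement]

lemma map_handles_eq (f : Free n p →* Free n p) (k : ℕ)
    (hf : ∀ i : Fin p, (i : ℕ) < k → f (lam i) = lam i ∧ f (mu i) = mu i) :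
    f (handles n p k) = handles n p k := by
  rw [map_handles]
  unfold handles
  congr 1
  refine List.map_congr_left fun i hi => ?_
  have hlt : (i : ℕ) < k := by
    obtain ⟨m, hm, rfl⟩ := List.mem_take_iff_getElem.1 hi
    simp at hm ⊢
    omega
  rw [(hf i hlt).1, (hf i hlt).2]

/-- The endomorphism with prescribed values on the free generators. -/
def endo (Γ : Fin n → Free n p) (L M : Fin p → Free n p) : Free n p →* Free n p :=
  FreeGroup.lift fun x => match x with
    | .gam k => Γ k
    | .lam k => L k
    | .mu k => M k

lemma endo_γ (Γ : Fin n → Free n p) (L M : Fin p → Free n p) (k : Fin n) :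
    endo Γ L M (γ k) = Γ k := by simp [endo, γ]

lemma endo_lam (Γ : Fin n → Free n p) (L M : Fin p → Free n p) (k : Fin p) :
    endo Γ L M (lam k) = L k := by simp [endo, lam]

lemma endo_mu (Γ : Fin n → Free n p) (L M : Fin p → Free n p) (k : Fin p) :
    endo Γ L M (mu k) = M k := by simp [endo, mu]

lemma exists_aut (φ ψ : Free n p →* Free n p)
    (h1 : ∀ k, φ (ψ (γ k)) = γ k) (h2 : ∀ k, φ (ψ (lam k)) = lam k)
    (h3 : ∀ k, φ (ψ (mu k)) = mu k) (h4 : ∀ k, ψ (φ (γ k)) = γ k)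
    (h5 : ∀ k, ψ (φ (lam k)) = lam k) (h6 : ∀ k, ψ (φ (mu k)) = mu k) :
    ∃ h : MulAut (Free n p), ∀ x, h x = φ x :=
  ⟨MonoidHom.toMulEquiv φ ψ
    (FreeGroup.ext_hom _ _ fun x => match x with
      | .gam k => h4 k
      | .lam k => h5 k
      | .mu k => h6 k)
    (FreeGroup.ext_hom _ _ fun x => match x with
      | .gam k => h1 k
      | .lam k => h2 k
      | .mu k => h3 k),
    fun _ => rfl⟩

/-- An endomorphism which only moves `γ_l`, `λ_i`, `μ_i`, to `handles i * G * (handles i)⁻¹`, `A`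
and `B`. -/
def localEndo (l : Fin n) (i : Fin p) (G A B : Free n p) : Free n p →* Free n p :=
  endo (Function.update γ l (handles n p i * G * (handles n p i)⁻¹))
    (Function.update lam i A) (Function.update mu i B)

section Local

variable (l : Fin n) (i : Fin p) (G A B : Free n p)

lemma localEndo_γ (k : Fin n) (hk : k ≠ l) : localEndo l i G A B (γ k) = γ k := by
  simp [localEndo, endo_γ, hk]

lemma localEndo_lam (k : Fin p) (hk : k ≠ i) : localEndo l i G A B (lam k) = lam k := by
  simp [localEndo, endo_lam, hk]

lemma localEndo_mu (k : Fin p) (hk : k ≠ i) : localEndo l i G A B (mu k) = mu k := by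
  simp [localEndo, endo_mu, hk]

lemma localEndo_lam_self : localEndo l i G A B (lam i) = A := by
  simp [localEndo, endo_lam]

lemma localEndo_mu_self : localEndo l i G A B (mu i) = B := by
  simp [localEndo, endo_mu]

lemma localEndo_handles : localEndo l i G A B (handles n p i) = handles n p i :=
  map_handles_eq _ _ fun k hk => by
    have hne : k ≠ i := by rintro rfl; omega
    exact ⟨localEndo_lam _ _ _ _ _ _ hne, localEndo_mu _ _ _ _ _ _ hne⟩

lemma localEndo_slid : localEndo l i G A B (slid l i) = G := by
  have : localEndo l i G A B (γ l) = handles n p i * G * (handles n p i)⁻¹ := by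
    simp [localEndo, endo_γ]
  simp only [slid, map_mul, map_inv, localEndo_handles, this]
  group

/-- If `G, A, B` and `G', A', B'` are mutually inverse changes of the triple `slid l i, λ_i, μ_i`,
then the first one defines an automorphism. -/
lemma exists_localAut (G' A' B' : Free n p)
    (hG : localEndo l i G A B G' = slid l i) (hA : localEndo l i G A B A' = lam i)
    (hB : localEndo l i G A B B' = mu i)
    (hG' : localEndo l i G' A' B' G = slid l i) (hA' : localEndo l i G' A' B' A = lam i)
    (hB' : localEndo l i G' A' B' B = mu i) :
    ∃ h : MulAut (Free n p), ∀ x, h x = localEndo l i G A B x := by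
  have key : ∀ G A B : Free n p,
      localEndo l i G A B (γ l) = handles n p i * G * (handles n p i)⁻¹ := fun G A B => by
    simp [localEndo, endo_γ]
  have hγ : (γ l : Free n p) = handles n p i * slid l i * (handles n p i)⁻¹ := by
    simp only [slid]; group
  refine exists_aut _ (localEndo l i G' A' B') ?_ ?_ ?_ ?_ ?_ ?_ <;> intro k
  · by_cases hk : k = l
    · subst hk
      rw [key, map_mul, map_mul, map_inv, localEndo_handles, hG, ← hγ]
    · rw [localEndo_γ _ _ _ _ _ _ hk, localEndo_γ _ _ _ _ _ _ hk]
  · by_cases hk : k = i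
    · subst hk; rw [localEndo_lam_self, hA]
    · rw [localEndo_lam _ _ _ _ _ _ hk, localEndo_lam _ _ _ _ _ _ hk]
  · by_cases hk : k = i
    · subst hk; rw [localEndo_mu_self, hB]
    · rw [localEndo_mu _ _ _ _ _ _ hk, localEndo_mu _ _ _ _ _ _ hk]
  · by_cases hk : k = l
    · subst hk
      rw [key, map_mul, map_mul, map_inv, localEndo_handles, hG', ← hγ]
    · rw [localEndo_γ _ _ _ _ _ _ hk, localEndo_γ _ _ _ _ _ _ hk]
  · by_cases hk : k = i
    · subst hk; rw [localEndo_lam_self, hA']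
    · rw [localEndo_lam _ _ _ _ _ _ hk, localEndo_lam _ _ _ _ _ _ hk]
  · by_cases hk : k = i
    · subst hk; rw [localEndo_mu_self, hB']
    · rw [localEndo_mu _ _ _ _ _ _ hk, localEndo_mu _ _ _ _ _ _ hk]

end Local

lemma slid_succ (l : Fin n) (i : Fin p) :
    slid l (i + 1) = zetaElt l i := by
  simp only [zetaElt, slid, handles_succ]; group

theorem exists_isSigma (i j : Fin n) (hij : (i : ℕ) + 1 = j) :
    ∃ h : MulAut (Free n p), IsSigma i j h := by
  have hne : j ≠ i := by rintro rfl; omega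
  have hne' : i ≠ j := hne.symm
  let Γ : Fin n → Free n p :=
    fun k => if k = i then γ j else if k = j then (γ j)⁻¹ * γ i * γ j else γ k
  let Δ : Fin n → Free n p :=
    fun k => if k = i then γ i * γ j * (γ i)⁻¹ else if k = j then γ i else γ k
  obtain ⟨h, hh⟩ := exists_aut (endo Γ lam mu) (endo Δ lam mu)
    (fun k => by
      by_cases h1 : k = i
      · subst h1; simp [Γ, Δ, endo_γ, hne]; group
      · by_cases h2 : k = j
        · subst h2; simp [Γ, Δ, endo_γ, hne]
        · simp [Γ, Δ, endo_γ, h1, h2])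
    (fun k => by simp [endo_lam]) (fun k => by simp [endo_mu])
    (fun k => by
      by_cases h1 : k = i
      · subst h1; simp [Γ, Δ, endo_γ, hne]
      · by_cases h2 : k = j
        · subst h2; simp [Γ, Δ, endo_γ, hne]; group
        · simp [Γ, Δ, endo_γ, h1, h2])
    (fun k => by simp [endo_lam]) (fun k => by simp [endo_mu])
  refine ⟨h, hij, ?_, ?_, ?_, ?_, ?_⟩
  · simp [hh, Γ, endo_γ]
  · simp [hh, Γ, endo_γ, hne]
  · intro k h1 h2; simp [hh, Γ, endo_γ, h1, h2]
  · intro k; simp [hh, endo_lam]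
  · intro k; simp [hh, endo_mu]

theorem exists_isXiLam (l : Fin n) (i : Fin p) (hl : (l : ℕ) + 1 = n) :
    ∃ h : MulAut (Free n p), IsXiLam l i h := by
  obtain ⟨h, hh⟩ := exists_localAut l i
    ((lam i * (mu i)⁻¹ * (lam i)⁻¹ * (slid l i)⁻¹)⁻¹ * slid l i *
      (lam i * (mu i)⁻¹ * (lam i)⁻¹ * (slid l i)⁻¹)) (slid l i * lam i) (mu i)
    (lam i * (lam i * (mu i)⁻¹ * (lam i)⁻¹ * (slid l i)⁻¹ * lam i * mu i)⁻¹)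
    (lam i * (mu i)⁻¹ * (lam i)⁻¹ * (slid l i)⁻¹ * lam i * mu i) (mu i)
    (by simp only [map_mul, map_inv, localEndo_slid, localEndo_lam_self, localEndo_mu_self]; group)
    (by simp only [map_mul, map_inv, localEndo_slid, localEndo_lam_self, localEndo_mu_self]; group)
    (by rw [localEndo_mu_self])
    (by simp only [map_mul, map_inv, localEndo_slid, localEndo_lam_self, localEndo_mu_self]; group)
    (by simp only [map_mul, localEndo_slid, localEndo_lam_self]; group)
    (by rw [localEndo_mu_self])
  refine ⟨h, hl, ?_, ?_, ?_, ?_, ?_⟩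
  · rw [hh, localEndo_slid]
  · rw [hh, localEndo_lam_self]
  · intro k hk; rw [hh, localEndo_γ _ _ _ _ _ _ hk]
  · intro k hk; rw [hh, localEndo_lam _ _ _ _ _ _ hk]
  · intro k
    by_cases hk : k = i
    · subst hk; rw [hh, localEndo_mu_self]
    · rw [hh, localEndo_mu _ _ _ _ _ _ hk]

theorem exists_isXiMu (l : Fin n) (i : Fin p) (hl : (l : ℕ) + 1 = n) :
    ∃ h : MulAut (Free n p), IsXiMu l i h := by
  let C : Free n p := ⁅(lam i : Free n p), mu i⁆
  let g : Free n p := C⁻¹ * slid l i * C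
  have hg : slid l (i + 1) = g := slid_succ l i
  let c : Free n p := mu i * (lam i)⁻¹ * (mu i)⁻¹ * g
  let X : Free n p := ⁅(lam i : Free n p), g⁻¹ * mu i⁆
  let M : Free n p := mu i * (lam i)⁻¹ * (mu i)⁻¹ * g * mu i * lam i
  let Y : Free n p := ⁅(lam i : Free n p), M⁆
  obtain ⟨h, hh⟩ := exists_localAut l i
    (X * (c⁻¹ * g * c) * X⁻¹) (lam i) (g⁻¹ * mu i) (Y * (M * (mu i)⁻¹) * Y⁻¹) (lam i) M
    (by
      simp only [X, Y, M, c, g, C, commutatorElement_def, map_mul, map_inv, localEndo_slid,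
        localEndo_lam_self, localEndo_mu_self]
      group)
    (by rw [localEndo_lam_self])
    (by
      simp only [X, M, c, g, C, commutatorElement_def, map_mul, map_inv, localEndo_slid,
        localEndo_lam_self, localEndo_mu_self]
      group)
    (by
      simp only [X, Y, M, c, g, C, commutatorElement_def, map_mul, map_inv, localEndo_slid,
        localEndo_lam_self, localEndo_mu_self]
      group)
    (by rw [localEndo_lam_self])
    (by
      simp only [Y, M, g, C, commutatorElement_def, map_mul, map_inv, localEndo_slid,
        localEndo_lam_self, localEndo_mu_self]
      group)
  refine ⟨h, hl, ?_, ?_, ?_, ?_, ?_⟩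
  · rw [hh, hg]
    simp only [X, c, g, C, commutatorElement_def, map_mul, map_inv, localEndo_slid,
      localEndo_lam_self, localEndo_mu_self]
    group
  · rw [hh, localEndo_mu_self, hg]
  · intro k hk; rw [hh, localEndo_γ _ _ _ _ _ _ hk]
  · intro k
    by_cases hk : k = i
    · subst hk; rw [hh, localEndo_lam_self]
    · rw [hh, localEndo_lam _ _ _ _ _ _ hk]
  · intro k hk; rw [hh, localEndo_mu _ _ _ _ _ _ hk]

theorem exists_isZeta (l : Fin n) (i : Fin p) (hl : (l : ℕ) + 1 = n) :
    ∃ h : MulAut (Free n p), IsZeta l i h := by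
  let C : Free n p := ⁅(lam i : Free n p), mu i⁆
  let g : Free n p := slid l i
  obtain ⟨h, hh⟩ := exists_localAut l i
    (zetaElt l i) ((zetaElt l i)⁻¹ * lam i * zetaElt l i) ((zetaElt l i)⁻¹ * mu i * zetaElt l i)
    (g * C * g * C⁻¹ * g⁻¹) (g * lam i * g⁻¹) (g * mu i * g⁻¹)
    (by
      simp only [zetaElt, g, C, commutatorElement_def, map_mul, map_inv, localEndo_slid,
        localEndo_lam_self, localEndo_mu_self]
      group)
    (by
      simp only [zetaElt, g, commutatorElement_def, map_mul, map_inv, localEndo_slid,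
        localEndo_lam_self]
      group)
    (by
      simp only [zetaElt, g, commutatorElement_def, map_mul, map_inv, localEndo_slid,
        localEndo_mu_self]
      group)
    (by
      simp only [zetaElt, g, C, commutatorElement_def, map_mul, map_inv, localEndo_slid,
        localEndo_lam_self, localEndo_mu_self]
      group)
    (by
      simp only [zetaElt, g, C, commutatorElement_def, map_mul, map_inv, localEndo_slid,
        localEndo_lam_self, localEndo_mu_self]
      group)
    (by
      simp only [zetaElt, g, C, commutatorElement_def, map_mul, map_inv, localEndo_slid,
        localEndo_lam_self, localEndo_mu_self]
      group)
  refine ⟨h, hl, ?_, ?_, ?_, ?_, ?_, ?_⟩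
  · rw [hh, localEndo_slid]
  · rw [hh, localEndo_lam_self]
  · rw [hh, localEndo_mu_self]
  · intro k hk; rw [hh, localEndo_γ _ _ _ _ _ _ hk]
  · intro k hk; rw [hh, localEndo_lam _ _ _ _ _ _ hk]
  · intro k hk; rw [hh, localEndo_mu _ _ _ _ _ _ hk]

/-! The algebraic braid groups are themselves admissible. -/

lemma gammaProd_congr {α : Type*} [Group α] : ∀ {n : ℕ} (f g : Fin n → α) (i j : Fin n),
    (i : ℕ) + 1 = j → f i * f j = g i * g j → (∀ k, k ≠ i → k ≠ j → f k = g k) →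
    (List.ofFn f).prod = (List.ofFn g).prod := by
  intro n
  induction n with
  | zero => intro f g i; exact i.elim0
  | succ n ih =>
    intro f g i j hij hfg hk
    obtain ⟨j, rfl⟩ : ∃ j', j = Fin.succ j' := ⟨j.pred (by rintro rfl; simp at hij), by simp⟩
    rw [List.ofFn_succ, List.ofFn_succ, List.prod_cons, List.prod_cons]
    induction i using Fin.cases with
    | zero =>
      obtain ⟨n, rfl⟩ : ∃ m, n = m + 1 := ⟨n - 1, by have := j.2; omega⟩
      have hj : j = 0 := by ext; simp at hij; simp [← hij]
      subst hj
      rw [List.ofFn_succ, List.ofFn_succ, List.prod_cons, List.prod_cons, ← mul_assoc, hfg,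
        mul_assoc]
      congr 4
      funext k
      exact hk _ (Fin.succ_ne_zero _) fun h => Fin.succ_ne_zero k (Fin.succ_injective _ h)
    | succ i =>
      rw [hk 0 (Fin.succ_ne_zero _).symm (Fin.succ_ne_zero _).symm]
      congr 1
      refine ih _ _ i j (by simpa using hij) hfg fun k h1 h2 => hk _ ?_ ?_
      · exact fun h => h1 (Fin.succ_injective _ h)
      · exact fun h => h2 (Fin.succ_injective _ h)

/-- Splitting the boundary at the handle `i`. -/
lemma exists_boundary_eq (l : Fin n) (hl : (l : ℕ) + 1 = n) (i : Fin p) :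
    ∃ R : List (Fin n), ∃ S : List (Fin p), l ∉ R ∧ i ∉ S ∧
      boundary n p = (R.map γ).prod * handles n p i *
        (slid l i * ⁅(lam i : Free n p), mu i⁆) *
          (S.map fun k => ⁅(lam k : Free n p), mu k⁆).prod := by
  obtain ⟨m, rfl⟩ : ∃ m, n = m + 1 := ⟨_, hl.symm⟩
  obtain rfl : l = Fin.last m := by ext; simpa using hl
  refine ⟨List.ofFn fun k : Fin m => k.castSucc, (List.finRange p).drop (i + 1), ?_, ?_, ?_⟩
  · simp [List.mem_ofFn, Fin.castSucc_ne_last]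
  · intro h
    obtain ⟨a, ha, h⟩ := List.mem_drop_iff_getElem.1 h
    have := congrArg Fin.val h
    simp at this
    omega
  · have h1 : handles (m + 1) p p = handles (m + 1) p (i + 1) *
        (((List.finRange p).drop (i + 1)).map fun k =>
          ⁅(lam k : Free (m + 1) p), mu k⁆).prod := by
      unfold handles
      rw [← List.prod_append, ← List.map_append, List.take_append_drop,
        List.take_of_length_le (by simp)]
    have h2 : (List.ofFn fun j : Fin (m + 1) => (γ j : Free (m + 1) p)).prod =
        ((List.ofFn fun k : Fin m => k.castSucc).map γ).prod * γ (Fin.last m) := by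
      rw [List.ofFn_succ', List.concat_eq_append, List.prod_append, List.map_ofFn]
      simp [Function.comp_def]
    rw [boundary, h1, h2, handles_succ, slid]
    group

lemma boundary_fixed_of_local (l : Fin n) (hl : (l : ℕ) + 1 = n) (i : Fin p)
    (h : MulAut (Free n p))
    (hγ : ∀ k, k ≠ l → h (γ k) = γ k) (hlam : ∀ k, k ≠ i → h (lam k) = lam k)
    (hmu : ∀ k, k ≠ i → h (mu k) = mu k)
    (hmid : h (slid l i * ⁅(lam i : Free n p), mu i⁆) = slid l i * ⁅(lam i : Free n p), mu i⁆) :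
    h (boundary n p) = boundary n p := by
  obtain ⟨R, S, hR, hS, hb⟩ := exists_boundary_eq (p := p) l hl i
  have h1 : h (R.map γ).prod = (R.map γ).prod := by
    rw [map_list_prod, List.map_map]
    congr 1
    refine List.map_congr_left fun k hk => ?_
    exact hγ k fun e => hR (e ▸ hk)
  have h2 : h (S.map fun k => ⁅(lam k : Free n p), mu k⁆).prod =
      (S.map fun k => ⁅(lam k : Free n p), mu k⁆).prod := by
    rw [map_list_prod, List.map_map]
    congr 1
    refine List.map_congr_left fun k hk => ?_
    have hne : k ≠ i := fun e => hS (e ▸ hk)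
    simp [map_commutatorElement, hlam k hne, hmu k hne]
  have h3 : h (handles n p i) = handles n p i :=
    map_handles_eq h.toMonoidHom _ fun k hk => by
      have hne : k ≠ i := by rintro rfl; omega
      exact ⟨hlam k hne, hmu k hne⟩
  rw [hb, map_mul, map_mul, map_mul, h1, h2, h3, hmid]

lemma isConj_of_local (l : Fin n) (h : MulAut (Free n p))
    (hγ : ∀ k, k ≠ l → h (γ k) = γ k) (w c : Free n p)
    (hs : h (w⁻¹ * γ l * w) = c⁻¹ * (γ l) * c) :
    ∃ σ : Equiv.Perm (Fin n), ∀ k, IsConj (h (γ k)) (γ (σ k)) := by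
  refine ⟨1, fun k => ?_⟩
  by_cases hk : k = l
  · subst hk
    rw [isConj_iff]
    refine ⟨c * (h w)⁻¹, ?_⟩
    have : h (γ k) = h w * (c⁻¹ * γ k * c) * (h w)⁻¹ := by
      rw [← hs]; simp only [map_mul, map_inv]; group
    rw [this]; simp only [Equiv.Perm.one_apply]; group
  · rw [hγ k hk]; exact IsConj.refl _

theorem braidGroup_isAdmissible : IsAdmissible (braidGroup n p) where
  braid_le := le_rfl
  conj := by
    intro h hh
    induction hh using Subgroup.closure_induction with
    | mem h hh =>
      rcases hh with ((⟨i, j, hh⟩ | ⟨l, i, hh⟩) | ⟨l, i, hh⟩) | ⟨l, i, hh⟩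
      · refine ⟨Equiv.swap i j, fun k => ?_⟩
        by_cases h1 : k = i
        · subst h1; rw [hh.map_i, Equiv.swap_apply_left]
        · by_cases h2 : k = j
          · subst h2
            rw [hh.map_j, Equiv.swap_apply_right, isConj_iff]
            exact ⟨γ k, by group⟩
          · rw [hh.map_γ k h1 h2, Equiv.swap_apply_of_ne_of_ne h1 h2]
      · refine isConj_of_local l h hh.map_γ (handles n p i)
          (handles n p i * (lam i * (mu i)⁻¹ * (lam i)⁻¹ * (slid l i)⁻¹)) (hh.map_slid.trans ?_)
        simp only [slid]; group
      · refine isConj_of_local l h hh.map_γ (handles n p (i + 1))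
          (handles n p (i + 1) * (mu i * (lam i)⁻¹ * (mu i)⁻¹ * slid l (i + 1))) (hh.map_slid.trans ?_)
        simp only [slid]; group
      · refine isConj_of_local l h hh.map_γ (handles n p i)
          (handles n p i * ⁅(lam i : Free n p), mu i⁆) (hh.map_slid.trans ?_)
        simp only [zetaElt, slid]; group
    | one => exact ⟨1, fun k => IsConj.refl _⟩
    | mul a b _ _ ha hb =>
      obtain ⟨σ, hσ⟩ := ha
      obtain ⟨τ, hτ⟩ := hb
      exact ⟨σ * τ, fun k => ((a.toMonoidHom.map_isConj (hτ k)).trans (hσ (τ k)))⟩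
    | inv a _ ha =>
      obtain ⟨σ, hσ⟩ := ha
      refine ⟨σ⁻¹, fun k => ?_⟩
      have := (a⁻¹).toMonoidHom.map_isConj (hσ (σ⁻¹ k))
      simpa using this.symm
  boundary_fixed := by
    intro h hh
    induction hh using Subgroup.closure_induction with
    | mem h hh =>
      rcases hh with ((⟨i, j, hh⟩ | ⟨l, i, hh⟩) | ⟨l, i, hh⟩) | ⟨l, i, hh⟩
      · have h1 : h (handles n p p) = handles n p p :=
          map_handles_eq h.toMonoidHom _ fun k _ => ⟨hh.map_lam k, hh.map_mu k⟩
        rw [boundary, map_mul, h1, map_list_prod, List.map_ofFn]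
        congr 1
        refine gammaProd_congr _ _ i j hh.succ ?_ fun k h1 h2 => hh.map_γ k h1 h2
        simp only [Function.comp_apply, hh.map_i, hh.map_j]; group
      · refine boundary_fixed_of_local l hh.last i h hh.map_γ hh.map_lam (fun k _ => hh.map_mu k) ?_
        simp only [commutatorElement_def, map_mul, map_inv, hh.map_slid, hh.map_lam_self, hh.map_mu]
        group
      · refine boundary_fixed_of_local l hh.last i h hh.map_γ (fun k _ => hh.map_lam k) hh.map_mu ?_
        have hs : slid l i * ⁅(lam i : Free n p), mu i⁆ =
            ⁅(lam i : Free n p), mu i⁆ * slid l (i + 1) := by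
          rw [slid_succ, zetaElt]; group
        rw [hs]
        simp only [commutatorElement_def, map_mul, map_inv, hh.map_slid, hh.map_mu_self, hh.map_lam]
        group
      · refine boundary_fixed_of_local l hh.last i h hh.map_γ hh.map_lam hh.map_mu ?_
        simp only [commutatorElement_def, map_mul, map_inv, hh.map_slid, hh.map_lam_self,
          hh.map_mu_self]
        simp only [zetaElt, commutatorElement_def]
        group
    | one => rfl
    | mul a b _ _ ha hb => rw [MulAut.mul_apply, hb, ha]
    | inv a _ ha =>
      apply a.injective
      rw [MulAut.apply_inv_self, ha]

end Frames

/-- A collection `H_{n,p}`, `n, p ≥ 0`, of admissible groups of automorphisms. -/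
structure AdmissibleCollection where
  grp : ∀ n p : ℕ, Subgroup (MulAut (Free n p))
  admissible : ∀ n p : ℕ, IsAdmissible (grp n p)

/-- The collection of the algebraic braid groups `Br_{n,p}`. -/
def braidCollection : AdmissibleCollection where
  grp := braidGroup
  admissible _ _ := braidGroup_isAdmissible

/-- An equipment of a group `G`: a finite ordered list of distinct conjugacy classes
`C₁, …, C_m` of `G`, none of them the class of `1`. -/
structure Equipment (G : Type*) [Group G] where
  m : ℕ
  cls : Fin m → ConjClasses G
  cls_injective : Function.Injective cls
  cls_ne_one : ∀ i, cls i ≠ ConjClasses.mk 1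

variable {G : Type*} [Group G]

/-- The set `O = C₁ ⊔ ⋯ ⊔ C_m` of an equipped group `(G, O)`. -/
def Equipment.carrier (O : Equipment G) : Set G := {g | ∃ i, ConjClasses.mk g = O.cls i}

/-- The alphabet `{x_g | g ∈ O} ∪ {y_{a,b} | a, b ∈ G}`. -/
inductive Letter (O : Equipment G) : Type _
  | x (g : O.carrier)
  | y (a b : G)

/-- The free covering semigroup over `(G, O)`. -/
abbrev FreeCovering (O : Equipment G) : Type _ := FreeSemigroup (Letter O)

/-- The nonempty list of letters of an element of the free covering semigroup. -/
def letters {O : Equipment G} (w : FreeCovering O) : List (Letter O) := w.head :: w.tail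

/-- The list of letters `x_{f(γ₁)} ⋯ x_{f(γₙ)} y_{f(λ₁), f(μ₁)} ⋯ y_{f(λₚ), f(μₚ)}` of an equipped
homomorphism `f : 𝔽^{n+2p} → (G, O)`. -/
def wordOf (O : Equipment G) {n p : ℕ} (f : Free n p →* G) (hf : ∀ i, f (γ i) ∈ O.carrier) :
    List (Letter O) :=
  (List.ofFn fun i : Fin n => Letter.x ⟨f (γ i), hf i⟩) ++
    List.ofFn fun i : Fin p => Letter.y (f (lam i)) (f (mu i))

/-- The relations `x_g y_{a,b} = y_{a,b} x_{g'}` with `g' = [a,b]⁻¹ g [a,b]`. -/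
def QuasiFreeRel (O : Equipment G) (w w' : FreeCovering O) : Prop :=
  ∃ (g g' : O.carrier) (a b : G), (g' : G) = ⁅a, b⁆⁻¹ * g * ⁅a, b⁆ ∧
    letters w = [Letter.x g, Letter.y a b] ∧ letters w' = [Letter.y a b, Letter.x g']

/-- The relations `R_h` attached to an automorphism `h` of `𝔽^{n+2p}`: the tuple
`(g₁, …, gₙ, a₁, b₁, …, aₚ, bₚ) ∈ Oⁿ × G^{2p}` is the same thing as an equipped homomorphism `f`,
and the right-hand side of the relation is the word of the equipped homomorphism `f ∘ h`. -/
def AutRel (O : Equipment G) {n p : ℕ} (h : MulAut (Free n p)) (w w' : FreeCovering O) : Prop :=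
  ∃ (f : Free n p →* G) (hf : ∀ i, f (γ i) ∈ O.carrier)
    (hf' : ∀ i, (f.comp h.toMonoidHom) (γ i) ∈ O.carrier),
    letters w = wordOf O f hf ∧ letters w' = wordOf O (f.comp h.toMonoidHom) hf'

/-- The congruence generated by the quasi-free relations and all `R_h`, `h ∈ H_{n,p}`,
`n, p ≥ 0`. -/
def coveringCon (H : AdmissibleCollection) (O : Equipment G) : Con (FreeCovering O) :=
  conGen fun w w' =>
    QuasiFreeRel O w w' ∨ ∃ (n p : ℕ), ∃ h ∈ H.grp n p, AutRel O h w w'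

/-- The admissible covering semigroup `𝕊_{H-equiv}(G, O)`. -/
abbrev AdmissibleCovering (H : AdmissibleCollection) (O : Equipment G) : Type _ :=
  (coveringCon H O).Quotient

/-- The strong covering semigroup `𝕊(G, O)`. -/
abbrev StrongCovering (O : Equipment G) : Type _ := AdmissibleCovering braidCollection O

lemma braid_coveringCon_le (H : AdmissibleCollection) (O : Equipment G) :
    coveringCon braidCollection O ≤ coveringCon H O := by
  refine Con.conGen_le.2 fun w w' h => ?_
  refine ConGen.Rel.of _ _ ?_
  rcases h with h | ⟨n, p, a, ha, h⟩
  · exact Or.inl h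
  · exact Or.inr ⟨n, p, a, (H.admissible n p).braid_le ha, h⟩

/-- The natural epimorphism `r : 𝕊(G, O) → 𝕊_{H-equiv}(G, O)`. -/
def quotientHom (H : AdmissibleCollection) (O : Equipment G) :
    StrongCovering O →ₙ* AdmissibleCovering H O where
  toFun s := Con.liftOn s (fun w => (w : (coveringCon H O).Quotient)) fun _ _ h =>
    (Con.eq _).2 (braid_coveringCon_le H O h)
  map_mul' s t := by
    induction s using Con.induction_on
    induction t using Con.induction_on
    rfl

section Invariants

variable {O : Equipment G}

/-- The type of a letter: the `i`-th basis vector for `x_g` with `g ∈ C_i`, and `0` for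
`y_{a,b}`. -/
noncomputable def letterType : Letter O → Fin O.m → ℕ
  | .x g => fun i => open Classical in if ConjClasses.mk (g : G) = O.cls i then 1 else 0
  | .y _ _ => 0

/-- The type of a word: its `i`-th entry counts the letters `x_g` with `g ∈ C_i`. -/
noncomputable def wordType (w : FreeCovering O) : Fin O.m → ℕ := ((letters w).map letterType).sum

/-- The elements of `G` indexing a letter. -/
def letterSet : Letter O → Set G
  | .x g => {(g : G)}
  | .y a b => {a, b}

/-- The subgroup of `G` generated by all elements indexing the letters of a word. -/
def wordGroup (w : FreeCovering O) : Subgroup G :=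
  Subgroup.closure {c | ∃ z ∈ letters w, c ∈ letterSet z}

lemma letters_mul (w w' : FreeCovering O) : letters (w * w') = letters w ++ letters w' := by
  simp [letters]

lemma wordType_mul (w w' : FreeCovering O) : wordType (w * w') = wordType w + wordType w' := by
  simp [wordType, letters_mul]

lemma wordGroup_mul (w w' : FreeCovering O) :
    wordGroup (w * w') = wordGroup w ⊔ wordGroup w' := by
  rw [wordGroup, wordGroup, wordGroup, ← Subgroup.closure_union]
  congr 1
  ext c
  simp only [letters_mul, List.mem_append, Set.mem_ofPred_eq, Set.mem_union, or_and_right,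
    exists_or]

/-- The congruence "same type and same generated subgroup". -/
def invariantCon (O : Equipment G) : Con (FreeCovering O) where
  r w w' := wordType w = wordType w' ∧ wordGroup w = wordGroup w'
  iseqv := ⟨fun _ => ⟨rfl, rfl⟩, fun h => ⟨h.1.symm, h.2.symm⟩,
    fun h h' => ⟨h.1.trans h'.1, h.2.trans h'.2⟩⟩
  mul' h h' := by
    simp only [wordType_mul, wordGroup_mul]
    exact ⟨by rw [h.1, h'.1], by rw [h.2, h'.2]⟩

lemma closure_wordOf {n p : ℕ} (f : Free n p →* G) (hf : ∀ i, f (γ i) ∈ O.carrier) :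
    Subgroup.closure {c | ∃ z ∈ wordOf O f hf, c ∈ letterSet z} = f.range := by
  rw [MonoidHom.range_eq_map, ← FreeGroup.closure_range_of, MonoidHom.map_closure]
  congr 1
  ext c
  simp only [wordOf, List.mem_append, List.mem_ofFn, Set.mem_ofPred_eq, Set.mem_image,
    Set.mem_range]
  constructor
  · rintro ⟨z, ⟨i, rfl⟩ | ⟨i, rfl⟩, hc⟩
    · simp only [letterSet, Set.mem_singleton_iff] at hc
      exact ⟨_, ⟨.gam i, rfl⟩, hc.symm⟩
    · simp only [letterSet, Set.mem_insert_iff, Set.mem_singleton_iff] at hc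
      rcases hc with hc | hc
      · exact ⟨_, ⟨.lam i, rfl⟩, hc.symm⟩
      · exact ⟨_, ⟨.mu i, rfl⟩, hc.symm⟩
  · rintro ⟨_, ⟨k | k | k, rfl⟩, rfl⟩
    · exact ⟨_, Or.inl ⟨k, rfl⟩, rfl⟩
    · exact ⟨_, Or.inr ⟨k, rfl⟩, Or.inl rfl⟩
    · exact ⟨_, Or.inr ⟨k, rfl⟩, Or.inr rfl⟩

lemma sum_wordOf {n p : ℕ} (f : Free n p →* G) (hf : ∀ i, f (γ i) ∈ O.carrier) :
    ((wordOf O f hf).map letterType).sum = ∑ i, letterType (Letter.x ⟨f (γ i), hf i⟩) := by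
  have h0 : ((List.ofFn fun i : Fin p => (Letter.y (f (lam i)) (f (mu i)) : Letter O)).map
      letterType).sum = 0 := by
    apply List.sum_eq_zero
    simp [letterType]
  rw [wordOf, List.map_append, List.sum_append, h0, add_zero, List.map_ofFn, List.sum_ofFn]
  rfl

lemma letterType_eq_of_isConj {g g' : O.carrier} (h : IsConj (g : G) g') :
    letterType (Letter.x g) = letterType (Letter.x g') := by
  have := ConjClasses.mk_eq_mk_iff_isConj.2 h
  funext i
  classical
  exact if_congr (by rw [this]) rfl rfl

lemma coveringCon_le (H : AdmissibleCollection) (O : Equipment G) :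
    coveringCon H O ≤ invariantCon O := by
  refine Con.conGen_le.2 fun w w' h => ?_
  change wordType w = wordType w' ∧ wordGroup w = wordGroup w'
  rcases h with ⟨g, g', a, b, hg, h1, h2⟩ | ⟨n, p, h, hh, f, hf, hf', h1, h2⟩
  · constructor
    · rw [wordType, wordType, h1, h2]
      have : IsConj (g : G) g' := by
        rw [isConj_iff, hg]; exact ⟨⁅a, b⁆⁻¹, by simp⟩
      simp only [List.map_cons, List.map_nil, List.sum_cons, List.sum_nil,
        letterType_eq_of_isConj this]
      exact add_left_comm _ _ _
    · rw [wordGroup, wordGroup, h1, h2]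
      have e1 : {c | ∃ z ∈ [Letter.x g, Letter.y a b], c ∈ letterSet z} = {(g : G), a, b} := by
        ext c; simp [letterSet]
      have e2 : {c | ∃ z ∈ [Letter.y a b, Letter.x g'], c ∈ letterSet z} = {a, b, (g' : G)} := by
        ext c; simp [letterSet, or_assoc]
      rw [e1, e2]
      have key : ∀ K : Subgroup G, a ∈ K → b ∈ K → ⁅a, b⁆ ∈ K := fun K ha hb => by
        rw [commutatorElement_def]
        exact K.mul_mem (K.mul_mem (K.mul_mem ha hb) (K.inv_mem ha)) (K.inv_mem hb)
      apply le_antisymm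
      · have ma : a ∈ Subgroup.closure {a, b, (g' : G)} := Subgroup.subset_closure (by simp)
        have mb : b ∈ Subgroup.closure {a, b, (g' : G)} := Subgroup.subset_closure (by simp)
        have mg : (g' : G) ∈ Subgroup.closure {a, b, (g' : G)} :=
          Subgroup.subset_closure (by simp)
        rw [Subgroup.closure_le]
        rintro c (rfl | rfl | rfl)
        · have : (g : G) = ⁅a, b⁆ * g' * ⁅a, b⁆⁻¹ := by rw [hg]; group
          rw [SetLike.mem_coe, this]
          exact Subgroup.mul_mem _ (Subgroup.mul_mem _ (key _ ma mb) mg)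
            (Subgroup.inv_mem _ (key _ ma mb))
        · exact ma
        · exact mb
      · have ma : a ∈ Subgroup.closure {(g : G), a, b} := Subgroup.subset_closure (by simp)
        have mb : b ∈ Subgroup.closure {(g : G), a, b} := Subgroup.subset_closure (by simp)
        have mg : (g : G) ∈ Subgroup.closure {(g : G), a, b} :=
          Subgroup.subset_closure (by simp)
        rw [Subgroup.closure_le]
        rintro c (rfl | rfl | rfl)
        · exact ma
        · exact mb
        · rw [SetLike.mem_coe, hg]
          exact Subgroup.mul_mem _ (Subgroup.mul_mem _ (Subgroup.inv_mem _ (key _ ma mb)) mg)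
            (key _ ma mb)
  · constructor
    · rw [wordType, wordType, h1, h2, sum_wordOf, sum_wordOf]
      obtain ⟨σ, hσ⟩ := (H.admissible n p).conj h hh
      rw [← Equiv.sum_comp σ]
      refine Finset.sum_congr rfl fun i _ => letterType_eq_of_isConj ?_
      exact (f.map_isConj (hσ i)).symm
    · rw [wordGroup, wordGroup, h1, h2, closure_wordOf, closure_wordOf]
      ext c
      constructor
      · rintro ⟨z, rfl⟩
        exact ⟨h⁻¹ z, by simp⟩
      · rintro ⟨z, rfl⟩
        exact ⟨h z, rfl⟩

variable {H : AdmissibleCollection}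

/-- The type `τ(s)` of an element of a covering semigroup. On a reduced form
`x_{g₁} ⋯ x_{gₙ} y_{a₁,b₁} ⋯ y_{aₚ,bₚ}` of `s` its `i`-th entry is the number of `j` with
`g_j ∈ C_i`. -/
noncomputable def typ (s : AdmissibleCovering H O) : Fin O.m → ℕ :=
  Con.liftOn s wordType fun _ _ h => (coveringCon_le H O h).1

/-- The subgroup `G_s`. On a reduced form `x_{g₁} ⋯ x_{gₙ} y_{a₁,b₁} ⋯ y_{aₚ,bₚ}` of `s` it is the
subgroup generated by `g₁, …, gₙ, a₁, b₁, …, aₚ, bₚ`. -/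
def grpOf (s : AdmissibleCovering H O) : Subgroup G :=
  Con.liftOn s wordGroup fun _ _ h => (coveringCon_le H O h).2

lemma typ_mul (s t : AdmissibleCovering H O) : typ (s * t) = typ s + typ t := by
  induction s using Con.induction_on
  induction t using Con.induction_on
  exact wordType_mul _ _

lemma grpOf_mul (s t : AdmissibleCovering H O) : grpOf (s * t) = grpOf s ⊔ grpOf t := by
  induction s using Con.induction_on
  induction t using Con.induction_on
  exact wordGroup_mul _ _

lemma typ_quotientHom (s : StrongCovering O) : typ (quotientHom H O s) = typ s := by
  induction s using Con.induction_on
  rfl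

lemma grpOf_quotientHom (s : StrongCovering O) : grpOf (quotientHom H O s) = grpOf s := by
  induction s using Con.induction_on
  rfl

/-- The subsemigroup `𝕊_{H-equiv}(G, O)^G_{≥ T}` of all `s` with `G_s = G` and `τ_i(s) ≥ T_i` for
all `i`. -/
def largePart (H : AdmissibleCollection) (O : Equipment G) (T : Fin O.m → ℕ) :
    Subsemigroup (AdmissibleCovering H O) where
  carrier := {s | grpOf s = ⊤ ∧ ∀ i, T i ≤ typ s i}
  mul_mem' {s t} hs ht := by
    refine ⟨by rw [grpOf_mul, hs.1, top_sup_eq], fun i => ?_⟩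
    rw [typ_mul]
    exact (hs.2 i).trans (Nat.le_add_right _ _)

/-- The restriction `𝕊(G, O)^G_{≥ T} → 𝕊_{H-equiv}(G, O)^G_{≥ T}` of the natural epimorphism. -/
def restrictedQuotientHom (H : AdmissibleCollection) (O : Equipment G) (T : Fin O.m → ℕ) :
    largePart braidCollection O T →ₙ* largePart H O T where
  toFun s := ⟨quotientHom H O s, by
    refine ⟨?_, fun i => ?_⟩
    · rw [grpOf_quotientHom]; exact s.2.1
    · rw [typ_quotientHom]; exact s.2.2 i⟩
  map_mul' s t := Subtype.ext (map_mul (quotientHom H O) s.1 t.1)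

end Invariants

end CoveringSemigroup

namespace CoveringSemigroup

open scoped commutatorElement

/-! ### The structure monoid of `O` and the central powers `x_g ^ |G|`. -/

section XMonoid

variable {G : Type*} [Group G] {O : Equipment G}

/-! The theorem follows from invariants that every `r_H` preserves and that already separate the
elements of `𝕊(G, O)` of large type with `G_s = G`. They are the type, the number of handles
(factors `y`), and a value in the group `XGroup O`, in which `x_g x_h = x_h x_{g^h}` and `z_g = x_g
^ |G|` becomes trivial.

Invariance: `XGroup O` is a central extension of `G`, so the commutator of lifts of `a` and `b`
depends only on `a, b` and can serve as the value of `y_{a,b}`. An equipped homomorphism `f` lifts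
to `XGroup O`, and the value of its word is the image of the boundary element under the lift. An
admissible `h` fixes the boundary and sends each `γ_i` to a conjugate of some `γ_j`, whose image is
again a generator of `XGroup O`. Hence the value survives (`wordValue_eq_of_autRel`,
`coveringCon_le_ker`).

Completeness (`eq_of_value_eq`): the `z_g` are central, and if `G_s = G` then `z_g s` depends only
on the conjugacy class of `g` (`group_le_stabilizer`). By the pigeonhole principle an element of
large type is divisible by any prescribed product of `z`'s (`exists_eq_zprod_mul`). Spending such
factors on the `ξ`-relations turns every `y_{a,b}` into `y_{1,1}`, so `s = m y_{1,1}^k` with `m` in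
the structure monoid (`exists_eq_ofX_mul_Y_one_pow`), and `k` is the number of handles. Equality of
values means that two such `m, m'` agree after multiplication by products of `z`'s; equality of
types makes these two products interchangeable, and a Noetherian argument (`exists_uniform_pow`)
shows that a bounded multiple, already contained in elements of large type, suffices for the
cancellation. -/

lemma Equipment.conj_mem (g : O.carrier) (h : G) : h⁻¹ * g * h ∈ O.carrier := by
  obtain ⟨i, hi⟩ := g.2
  refine ⟨i, hi ▸ ?_⟩
  rw [ConjClasses.mk_eq_mk_iff_isConj, isConj_iff]
  exact ⟨h, by group⟩

/-- The element `g^h = h⁻¹ g h` of `O`. -/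
def conj (g : O.carrier) (h : G) : O.carrier := ⟨h⁻¹ * g * h, O.conj_mem g h⟩

@[simp] lemma coe_conj (g : O.carrier) (h : G) : (conj g h : G) = h⁻¹ * g * h := rfl

@[simp] lemma conj_one (g : O.carrier) : conj g 1 = g := Subtype.ext (by simp)

lemma conj_mul (g : O.carrier) (h k : G) : conj g (h * k) = conj (conj g h) k :=
  Subtype.ext (by simp only [coe_conj]; group)

/-- The structure monoid of the set `O`: the monoid with generators `x_g`, `g ∈ O`, and relations
`x_g x_h = x_h x_{g^h}`. -/
abbrev XMonoid (O : Equipment G) : Type _ :=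
  (conGen fun w w' : FreeMonoid O.carrier => ∃ g h : O.carrier,
    w = FreeMonoid.of g * FreeMonoid.of h ∧
      w' = FreeMonoid.of h * FreeMonoid.of (conj g (h : G))).Quotient

namespace XMonoid

/-- The generator `x_g` of the structure monoid. -/
def x (g : O.carrier) : XMonoid O := Con.toQuotient (FreeMonoid.of g)

lemma x_mul_x (g h : O.carrier) : x g * x h = x h * x (conj g (h : G)) :=
  (Con.eq _).2 (ConGen.Rel.of _ _ ⟨g, h, rfl, rfl⟩)

/-- The product of the generators indexed by a list. -/
def xprod (l : List O.carrier) : XMonoid O := (l.map x).prod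

@[simp] lemma xprod_nil : xprod ([] : List O.carrier) = 1 := rfl

@[simp] lemma xprod_cons (g : O.carrier) (l : List O.carrier) :
    xprod (g :: l) = x g * xprod l := by
  simp [xprod]

lemma exists_xprod (m : XMonoid O) : ∃ l, m = xprod l := by
  induction m using Con.induction_on with
  | H w =>
    induction w using FreeMonoid.inductionOn' with
    | one => exact ⟨[], rfl⟩
    | of_mul g w ih =>
      obtain ⟨l, hl⟩ := ih
      exact ⟨g :: l, by rw [xprod_cons, ← hl]; rfl⟩

@[elab_as_elim]
lemma induction {C : XMonoid O → Prop} (one : C 1) (mul : ∀ g m, C m → C (x g * m))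
    (m : XMonoid O) : C m := by
  obtain ⟨l, rfl⟩ := exists_xprod m
  induction l with
  | nil => exact one
  | cons g l ih => rw [xprod_cons]; exact mul _ _ ih

/-- The universal property of the structure monoid. -/
def lift {α : Type*} [Monoid α] (F : O.carrier → α)
    (hF : ∀ g h : O.carrier, F g * F h = F h * F (conj g (h : G))) : XMonoid O →* α :=
  Con.lift _ (FreeMonoid.lift F) <| Con.conGen_le.2 <| by
    rintro _ _ ⟨g, h, rfl, rfl⟩
    simpa [Con.ker_rel] using hF g h

@[simp] lemma lift_x {α : Type*} [Monoid α] (F : O.carrier → α)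
    (hF : ∀ g h : O.carrier, F g * F h = F h * F (conj g (h : G))) (g : O.carrier) :
    lift F hF (x g) = F g := by
  change FreeMonoid.lift F (FreeMonoid.of g) = F g
  simp

lemma x_mul_pow (g h : O.carrier) (k : ℕ) :
    x g * x h ^ k = x h ^ k * x (conj g ((h : G) ^ k)) := by
  induction k with
  | zero => simp
  | succ k ih =>
    rw [pow_succ, ← mul_assoc, ih, mul_assoc, x_mul_x, ← mul_assoc, pow_succ, conj_mul]

lemma pow_mul_x (g h : O.carrier) (k : ℕ) :
    x g ^ k * x h = x h * x (conj g (h : G)) ^ k := by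
  induction k with
  | zero => simp
  | succ k ih =>
    rw [pow_succ, mul_assoc, x_mul_x, ← mul_assoc, ih, mul_assoc, pow_succ]

/-- All occurrences of `x_g` in a word can be moved to the front. -/
lemma exists_xprod_eq_pow_mul [DecidableEq O.carrier] (g : O.carrier) (l : List O.carrier) :
    ∃ l', xprod l = x g ^ l.count g * xprod l' ∧ l'.length + l.count g = l.length := by
  induction l with
  | nil => exact ⟨[], by simp⟩
  | cons h l ih =>
    obtain ⟨l', hl, hc⟩ := ih
    by_cases hg : h = g
    · subst hg
      refine ⟨l', ?_, by simp; omega⟩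
      rw [xprod_cons, hl, List.count_cons_self, pow_succ', mul_assoc]
    · refine ⟨conj h ((g : G) ^ l.count g) :: l', ?_, ?_⟩
      · rw [xprod_cons, hl, List.count_cons_of_ne hg, ← mul_assoc, x_mul_pow, mul_assoc,
          xprod_cons]
      · rw [List.count_cons_of_ne hg]; simp; omega

/-- The power `x_g ^ |G|`, which is central. -/
noncomputable def z (g : O.carrier) : XMonoid O := x g ^ Nat.card G

/-- The product of the central elements `z_g` over a list. -/
noncomputable def zprod (l : List O.carrier) : XMonoid O := (l.map z).prod

@[simp] lemma zprod_nil : zprod ([] : List O.carrier) = 1 := rfl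

@[simp] lemma zprod_cons (g : O.carrier) (l : List O.carrier) :
    zprod (g :: l) = z g * zprod l := by
  simp [zprod]

lemma zprod_append (l l' : List O.carrier) : zprod (l ++ l') = zprod l * zprod l' := by
  simp [zprod]

lemma zprod_replicate_flatten (l : List O.carrier) (k : ℕ) :
    zprod (List.replicate k l).flatten = zprod l ^ k := by
  induction k with
  | zero => simp
  | succ k ih => rw [List.replicate_succ, List.flatten_cons, zprod_append, ih, pow_succ']

lemma x_mul_z (g h : O.carrier) : x g * z h = z h * x g := by
  rw [z, x_mul_pow, pow_card_eq_one', conj_one]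

/-- Together with the centrality of the `z`'s this shows that `z_g` and `z_{g^h}` have the same
product with `x_h`; the later independence of `z_g` from the representative of its class starts
here. -/
lemma z_mul_x (g h : O.carrier) : z g * x h = x h * z (conj g (h : G)) := pow_mul_x g h _

lemma z_comm (g : O.carrier) (m : XMonoid O) : z g * m = m * z g := by
  induction m using induction with
  | one => simp
  | mul h m ih => rw [← mul_assoc, ← x_mul_z, mul_assoc, ih, mul_assoc]

lemma zprod_comm (l : List O.carrier) (m : XMonoid O) : zprod l * m = m * zprod l := by
  induction l with
  | nil => simp
  | cons g l ih => rw [zprod_cons, mul_assoc, ih, ← mul_assoc, z_comm, mul_assoc]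

variable [Finite G]

/-- Each letter `x_g` is completed to `z_g` by `x_g ^ (|G| - 1)`. This yields inverses once the
`z`'s are made trivial. -/
lemma exists_mul_eq_zprod (m : XMonoid O) : ∃ m' l, m' * m = zprod l := by
  induction m using induction with
  | one => exact ⟨1, [], by simp⟩
  | mul g m ih =>
    obtain ⟨m', l, h⟩ := ih
    refine ⟨m' * x g ^ (Nat.card G - 1), g :: l, ?_⟩
    rw [mul_assoc, ← mul_assoc _ (x g), ← pow_succ, Nat.sub_add_cancel Nat.card_pos, ← z, z_comm,
      ← mul_assoc, h, ← z_comm, zprod_cons]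

end XMonoid

end XMonoid

/-! ### Finiteness over the central powers and uniform cancellation. -/

lemma exists_lt_count {α : Type*} [Fintype α] [DecidableEq α] (l : List α) (n : ℕ)
    (h : Fintype.card α * n < l.length) : ∃ a, n < l.count a := by
  by_contra! hcon
  refine h.not_ge ?_
  calc l.length = ∑ a, l.count a := by
        have := Multiset.sum_count_eq_card (s := Finset.univ) (m := (l : Multiset α))
          (fun _ _ => Finset.mem_univ _)
        simpa using this.symm
    _ ≤ ∑ _a : α, n := Finset.sum_le_sum fun a _ => hcon a
    _ = Fintype.card α * n := by simp

namespace XMonoid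

variable {G : Type*} [Group G] {O : Equipment G} [Finite G]

/-- The structure monoid is finite over the central submonoid generated by the `z_g`. -/
lemma exists_finite_generating (O : Equipment G) :
    ∃ F : Set (XMonoid O), F.Finite ∧ ∀ m : XMonoid O, ∃ l, ∃ f ∈ F, m = zprod l * f := by
  have : DecidableEq O.carrier := Classical.decEq _
  have := Fintype.ofFinite O.carrier
  -- A word longer than this repeats some letter more than `|G|` times, so a factor `z_g` splits off
  -- and the word gets shorter.
  let L := Fintype.card O.carrier * Nat.card G
  refine ⟨xprod '' {l | l.length ≤ L}, (List.finite_length_le _ _).image _, fun m => ?_⟩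
  obtain ⟨l, rfl⟩ := exists_xprod m
  induction hn : l.length using Nat.strong_induction_on generalizing l with
  | _ n ih =>
    subst hn
    by_cases hl : l.length ≤ L
    · exact ⟨[], _, ⟨l, hl, rfl⟩, by simp⟩
    · obtain ⟨g, hg⟩ := exists_lt_count l _ (not_le.1 hl)
      obtain ⟨l', h1, h2⟩ := exists_xprod_eq_pow_mul g l
      have hr : xprod l = z g * xprod (List.replicate (l.count g - Nat.card G) g ++ l') := by
        rw [h1, z, xprod, xprod, List.map_append, List.prod_append, List.map_replicate,
          List.prod_replicate, ← mul_assoc, ← pow_add, Nat.add_sub_cancel' hg.le]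
      have hpos : 0 < Nat.card G := Nat.card_pos
      have hlt : (List.replicate (l.count g - Nat.card G) g ++ l').length < l.length := by
        rw [List.length_append, List.length_replicate]; omega
      obtain ⟨l'', f, hf, h3⟩ := ih _ hlt _ rfl
      exact ⟨g :: l'', f, hf, by rw [hr, h3, zprod_cons, mul_assoc]⟩

/-- Equality after multiplication by some power of an element is equality after
multiplication by a fixed power. -/
lemma exists_uniform_pow (c : XMonoid O) :
    ∃ K : ℕ, ∀ a b : XMonoid O, (∃ n, c ^ n * a = c ^ n * b) → c ^ K * a = c ^ K * b := by
  -- The monoid ring is a finite module over the Noetherian ring `ℤ[X_g : g ∈ O]`, with `X_g` acting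
  -- as the central element `z_g`. It is therefore a Noetherian module.
  let A := MonoidAlgebra ℤ (XMonoid O)
  let R := MvPolynomial O.carrier ℤ
  have hz : ∀ g : O.carrier, MonoidAlgebra.of ℤ (XMonoid O) (z g) ∈ Subalgebra.center ℤ A := by
    intro g
    rw [Subalgebra.mem_center_iff]
    intro b
    induction b using MonoidAlgebra.induction_on with
    | of m => rw [← map_mul, ← map_mul, z_comm]
    | add a b ha hb => rw [add_mul, mul_add, ha, hb]
    | smul r a ha => rw [smul_mul_assoc, mul_smul_comm, ha]
  let φ : R →ₐ[ℤ] Subalgebra.center ℤ A := MvPolynomial.aeval fun g => ⟨_, hz g⟩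
  let ψ : R →+* A := ((Subalgebra.center ℤ A).val.comp φ).toRingHom
  let _ : Algebra R A := RingHom.toAlgebra' ψ fun r a =>
    (Subalgebra.mem_center_iff.1 (φ r).2 a).symm
  have hsmul : ∀ (r : R) (a : A), r • a = ψ r * a := fun r a => rfl
  have hψ : ∀ g, ψ (MvPolynomial.X g) = MonoidAlgebra.of ℤ (XMonoid O) (z g) := fun g => by
    change ((φ (MvPolynomial.X g) : Subalgebra.center ℤ A) : A) = _
    rw [MvPolynomial.aeval_X]
  obtain ⟨F, hF, hgen⟩ := exists_finite_generating O
  have hfin : Module.Finite R A := by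
    refine ⟨⟨(hF.image (MonoidAlgebra.of ℤ (XMonoid O))).toFinset, ?_⟩⟩
    rw [Set.Finite.coe_toFinset, eq_top_iff]
    rintro a -
    set S := Submodule.span R (MonoidAlgebra.of ℤ (XMonoid O) '' F)
    induction a using MonoidAlgebra.induction_on with
    | of m =>
      obtain ⟨l, f, hf, rfl⟩ := hgen m
      induction l with
      | nil => rw [zprod_nil, one_mul]; exact Submodule.subset_span ⟨f, hf, rfl⟩
      | cons g l ih =>
        rw [zprod_cons, mul_assoc, map_mul, ← hψ, ← hsmul]
        exact S.smul_mem _ ih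
    | add a b ha hb => exact S.add_mem ha hb
    | smul r a ha => exact zsmul_mem ha r
  have : IsNoetherian R A := isNoetherian_of_isNoetherianRing_of_finite R A
  let T : A →ₗ[R] A := LinearMap.mulLeft R (MonoidAlgebra.of ℤ (XMonoid O) c)
  have hT : ∀ (n : ℕ) (m : XMonoid O), (T ^ n) (MonoidAlgebra.of ℤ (XMonoid O) m) =
      MonoidAlgebra.of ℤ (XMonoid O) (c ^ n * m) := by
    intro n m
    simp only [T, LinearMap.pow_mulLeft, LinearMap.mulLeft_apply, map_mul, map_pow]
  -- The kernels of the powers of left multiplication by `c` form an ascending chain, which stops at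
  -- some `K`; two monoid elements are then compared through their difference in the ring.
  obtain ⟨K, hK⟩ := Filter.eventually_atTop.mp T.eventually_iSup_ker_pow_eq
  refine ⟨K, fun a b ⟨n, hab⟩ => ?_⟩
  apply MonoidAlgebra.of_injective (R := ℤ)
  rw [← hT, ← hT, ← sub_eq_zero, ← map_sub, ← LinearMap.mem_ker, ← hK K le_rfl]
  refine Submodule.mem_iSup_of_mem n ?_
  rw [LinearMap.mem_ker, map_sub, hT, hT, hab, sub_self]

end XMonoid

/-! ### The central extension of `G` and the invariant with values in it. -/

section CentralQuotient

variable {G : Type*} [Group G]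

open XMonoid

/-- The congruence on the structure monoid which identifies all `z_g` with `1`. -/
def zCon (O : Equipment G) : Con (XMonoid O) where
  r a b := ∃ l l', zprod l * a = zprod l' * b
  iseqv := by
    refine ⟨fun a => ⟨[], [], rfl⟩, fun ⟨l, l', h⟩ => ⟨l', l, h.symm⟩, ?_⟩
    rintro a b c ⟨l, l', h⟩ ⟨k, k', h'⟩
    refine ⟨k ++ l, l' ++ k', ?_⟩
    rw [zprod_append, zprod_append, mul_assoc, h, ← mul_assoc, zprod_comm, mul_assoc, h',
      ← mul_assoc]
  mul' := by
    rintro a b c d ⟨l, l', h⟩ ⟨k, k', h'⟩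
    refine ⟨l ++ k, l' ++ k', ?_⟩
    have e : ∀ (s t : List O.carrier) (u v : XMonoid O),
        zprod (s ++ t) * (u * v) = zprod s * u * (zprod t * v) := fun s t u v => by
      rw [zprod_append, mul_assoc, ← mul_assoc (zprod t), zprod_comm t u]
      simp only [mul_assoc]
    rw [e, e, h, h']

variable {O : Equipment G}

/-- The finite central extension of `G` with generators `x_g`, `g ∈ O`, and relations
`x_g x_h = x_h x_{g^h}`, `x_g ^ |G| = 1`. -/
abbrev XGroup (O : Equipment G) : Type _ := (zCon O).Quotient

namespace XGroup

/-- The natural homomorphism from the structure monoid. -/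
def ofMonoid (O : Equipment G) : XMonoid O →* XGroup O := (zCon O).mk'

lemma ofMonoid_surjective : Function.Surjective (ofMonoid O) := Con.mk'_surjective

lemma ofMonoid_eq_iff {a b : XMonoid O} :
    ofMonoid O a = ofMonoid O b ↔ ∃ l l', zprod l * a = zprod l' * b :=
  Con.eq _

/-- The homomorphism `x_g ↦ g` from the structure monoid to `G`. -/
def monoidToGroup (O : Equipment G) : XMonoid O →* G :=
  XMonoid.lift (fun g => (g : G)) fun g h => by simp [mul_assoc]

lemma monoidToGroup_zprod (l : List O.carrier) : monoidToGroup O (zprod l) = 1 := by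
  induction l with
  | nil => simp
  | cons g l ih => rw [zprod_cons, map_mul, ih, z, map_pow, pow_card_eq_one', one_mul]

/-- The generators of `XGroup O`. -/
def x (g : O.carrier) : XGroup O := ofMonoid O (XMonoid.x g)

/-- The homomorphism `x_g ↦ g`. -/
def toGroup (O : Equipment G) : XGroup O →* G :=
  Con.lift _ (monoidToGroup O) <| by
    rintro a b ⟨l, l', h⟩
    have := congrArg (monoidToGroup O) h
    simpa [monoidToGroup_zprod, Con.ker_rel] using this

@[simp] lemma toGroup_x (g : O.carrier) : toGroup O (x g) = g := by
  change monoidToGroup O (XMonoid.x g) = g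
  simp [monoidToGroup]

@[elab_as_elim]
lemma induction {C : XGroup O → Prop} (one : C 1) (mul : ∀ g m, C m → C (x g * m))
    (m : XGroup O) : C m := by
  obtain ⟨m, rfl⟩ := ofMonoid_surjective m
  induction m using XMonoid.induction with
  | one => rw [map_one]; exact one
  | mul g m ih => rw [map_mul]; exact mul _ _ ih

lemma x_mul (g : O.carrier) (u : XGroup O) : x g * u = u * x (conj g (toGroup O u)) := by
  induction u using induction generalizing g with
  | one => simp
  | mul h u ih =>
    have : x g * x h = x h * x (conj g (h : G)) := by
      rw [x, x, x, ← map_mul, XMonoid.x_mul_x, map_mul]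
    rw [← mul_assoc, this, mul_assoc, ih, ← mul_assoc, map_mul, toGroup_x, conj_mul]

/-- By `x_mul`, conjugation permutes the generators through the image in `G`, so the kernel of
`toGroup O` is central. -/
lemma central_of_toGroup_eq_one {u : XGroup O} (hu : toGroup O u = 1) (v : XGroup O) :
    v * u = u * v := by
  induction v using induction with
  | one => simp
  | mul g v ih => rw [mul_assoc, ih, ← mul_assoc, x_mul, hu, conj_one, mul_assoc]

variable [Finite G]

lemma exists_inv (a : XGroup O) : ∃ b, b * a = 1 := by
  obtain ⟨m, rfl⟩ := ofMonoid_surjective a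
  obtain ⟨m', l, h⟩ := exists_mul_eq_zprod m
  refine ⟨ofMonoid O m', ?_⟩
  rw [← map_mul, h, ← map_one (ofMonoid O), ofMonoid_eq_iff]
  exact ⟨[], l, by simp⟩

noncomputable instance : Group (XGroup O) where
  inv a := (exists_inv a).choose
  inv_mul_cancel a := (exists_inv a).choose_spec

/-- Lifts of the same element differ by central elements, which cancel in commutators. This is what
makes a value for `y_{a,b}` possible. -/
lemma commutator_eq {u v u' v' : XGroup O} (hu : toGroup O u = toGroup O u')
    (hv : toGroup O v = toGroup O v') : ⁅u, v⁆ = ⁅u', v'⁆ := by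
  obtain ⟨k, rfl⟩ : ∃ k, u' = u * k := ⟨u⁻¹ * u', by simp⟩
  obtain ⟨l, rfl⟩ : ∃ l, v' = v * l := ⟨v⁻¹ * v', by simp⟩
  have hk := central_of_toGroup_eq_one (u := k) (by simpa using hu)
  have hl := central_of_toGroup_eq_one (u := l) (by simpa using hv)
  have h1 : ⁅u * k, v * l⁆ = u * (k * (v * l) * k⁻¹) * u⁻¹ * (v * l)⁻¹ := by
    rw [commutatorElement_def]; group
  have h2 : u * (v * l) * u⁻¹ * (v * l)⁻¹ = u * v * (l * u⁻¹ * l⁻¹) * v⁻¹ := by group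
  rw [h1, ← hk, mul_inv_cancel_right, h2, ← hl, mul_inv_cancel_right, commutatorElement_def]

/-- The generators are closed under conjugation and each is determined by its image in `G`. -/
lemma eq_x_of_isConj {u : XGroup O} {g : O.carrier} (h : IsConj u (x g))
    (hu : toGroup O u ∈ O.carrier) : u = x ⟨toGroup O u, hu⟩ := by
  obtain ⟨c, hc⟩ := isConj_iff.1 h
  have : u = c⁻¹ * (x g * c) := by rw [← hc]; group
  have key : u = x (conj g (toGroup O c)) := by rw [this, x_mul]; group
  have hg : (⟨toGroup O u, hu⟩ : O.carrier) = conj g (toGroup O c) :=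
    Subtype.ext (by simpa using congrArg (toGroup O) key)
  rw [hg, ← key]

lemma toGroup_surjective (hO : Subgroup.closure O.carrier = ⊤) :
    Function.Surjective (toGroup O) := by
  rw [← MonoidHom.range_eq_top, eq_top_iff, ← hO, Subgroup.closure_le]
  exact fun g hg => ⟨x ⟨g, hg⟩, toGroup_x _⟩

/-- The commutator of arbitrary lifts of two elements of `G`. -/
noncomputable def y (hO : Subgroup.closure O.carrier = ⊤) (a b : G) : XGroup O :=
  ⁅(toGroup_surjective hO a).choose, (toGroup_surjective hO b).choose⁆

lemma commutator_eq_y (hO : Subgroup.closure O.carrier = ⊤) (u v : XGroup O) :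
    ⁅u, v⁆ = y hO (toGroup O u) (toGroup O v) :=
  commutator_eq (toGroup_surjective hO _).choose_spec.symm
    (toGroup_surjective hO _).choose_spec.symm

lemma toGroup_y (hO : Subgroup.closure O.carrier = ⊤) (a b : G) :
    toGroup O (y hO a b) = ⁅a, b⁆ := by
  rw [y, map_commutatorElement, (toGroup_surjective hO a).choose_spec,
    (toGroup_surjective hO b).choose_spec]

lemma y_one (hO : Subgroup.closure O.carrier = ⊤) : y hO 1 1 = 1 := by
  have := commutator_eq_y hO 1 1
  rw [map_one] at this
  rw [← this, commutatorElement_self]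

end XGroup

/-- The number (`0` or `1`) of handles of a letter. -/
def letterGenus : Letter O → Multiplicative ℕ
  | .x _ => 1
  | .y _ _ => Multiplicative.ofAdd 1

lemma prod_wordOf_letterGenus {n p : ℕ} (f : Free n p →* G) (hf : ∀ i, f (γ i) ∈ O.carrier) :
    ((wordOf O f hf).map letterGenus).prod = Multiplicative.ofAdd p := by
  simp [wordOf, List.map_ofFn, Function.comp_def, letterGenus, List.ofFn_const, ← ofAdd_nsmul]

variable [Finite G]

/-- The value of a letter in the group `XGroup O`. -/
noncomputable def letterValue (hO : Subgroup.closure O.carrier = ⊤) : Letter O → XGroup O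
  | .x g => XGroup.x g
  | .y a b => XGroup.y hO a b

/-- The value of a word in `XGroup O`, together with its number of handles. -/
noncomputable def wordValue (hO : Subgroup.closure O.carrier = ⊤) :
    FreeCovering O →ₙ* XGroup O × Multiplicative ℕ :=
  FreeSemigroup.lift fun z => (letterValue hO z, letterGenus z)

lemma wordValue_eq (hO : Subgroup.closure O.carrier = ⊤) (w : FreeCovering O) :
    wordValue hO w =
      (((letters w).map (letterValue hO)).prod, ((letters w).map letterGenus).prod) := by
  induction w using FreeSemigroup.recOnMul with
  | ih1 z => simp [wordValue, letters]
  | ih2 z w h1 h2 =>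
    rw [map_mul, h1, h2, letters_mul]
    simp

/-- The boundary element is built exactly like the word: generators for the `γ`'s, commutators for
the handles. The conjugacy hypothesis ensures that `f (γ i)` is the generator over its image and not
another lift. -/
lemma prod_wordOf_letterValue (hO : Subgroup.closure O.carrier = ⊤) {n p : ℕ}
    (f : Free n p →* XGroup O) (hf : ∀ i, ((XGroup.toGroup O).comp f) (γ i) ∈ O.carrier)
    (hf' : ∀ i, ∃ g, IsConj (f (γ i)) (XGroup.x g)) :
    ((wordOf O ((XGroup.toGroup O).comp f) hf).map (letterValue hO)).prod =
      f (boundary n p) := by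
  rw [boundary, map_mul, map_handles, wordOf, List.map_append, List.prod_append, map_list_prod,
    List.map_ofFn, List.map_ofFn, List.map_ofFn, List.take_of_length_le (by simp),
    ← List.ofFn_eq_map]
  congr 3
  · funext i
    obtain ⟨g, hg⟩ := hf' i
    exact (XGroup.eq_x_of_isConj hg (hf i)).symm
  · funext i
    exact (XGroup.commutator_eq_y hO _ _).symm

lemma wordValue_eq_of_autRel (hO : Subgroup.closure O.carrier = ⊤) {n p : ℕ}
    {H : Subgroup (MulAut (Free n p))} (hH : IsAdmissible H) {h : MulAut (Free n p)} (hh : h ∈ H)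
    {w w' : FreeCovering O} (hw : AutRel O h w w') : wordValue hO w = wordValue hO w' := by
  obtain ⟨f, hf, hf', h1, h2⟩ := hw
  rw [wordValue_eq, wordValue_eq, h1, h2, prod_wordOf_letterGenus, prod_wordOf_letterGenus]
  congr 1
  have hs := XGroup.toGroup_surjective hO
  -- A lift of `f`: the `γ`'s must go to generators, while any lifts will do for the `λ`'s and
  -- `μ`'s.
  let F : Free n p →* XGroup O := FreeGroup.lift fun i => match i with
    | .gam j => XGroup.x ⟨f (γ j), hf j⟩
    | .lam j => (hs (f (lam j))).choose
    | .mu j => (hs (f (mu j))).choose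
  have hFγ : ∀ j, F (γ j) = XGroup.x ⟨f (γ j), hf j⟩ := fun j => by simp [F, γ]
  have hF : f = (XGroup.toGroup O).comp F := by
    refine FreeGroup.ext_hom _ _ fun i => ?_
    rcases i with j | j | j
    · simp [F, γ]
    · simpa [F, lam] using (hs (f (lam j))).choose_spec.symm
    · simpa [F, mu] using (hs (f (mu j))).choose_spec.symm
  clear_value F
  subst hF
  -- `F ∘ h` lifts `f ∘ h`, and by admissibility it still sends each `γ_i` to a conjugate of a
  -- generator; both values are then images of the boundary, which `h` fixes.
  have := prod_wordOf_letterValue hO (F.comp h.toMonoidHom) hf' fun i => by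
    obtain ⟨σ, hσ⟩ := hH.conj h hh
    exact ⟨_, hFγ (σ i) ▸ F.map_isConj (hσ i)⟩
  rw [prod_wordOf_letterValue hO F hf fun i => ⟨⟨_, hf i⟩, isConj_iff.2 ⟨1, by
    rw [one_mul, inv_one, mul_one]; exact hFγ i⟩⟩]
  refine Eq.trans ?_ this.symm
  exact congrArg F (hH.boundary_fixed h hh).symm

/-- The value of a word in `XGroup O` only depends on the element of an admissible covering
semigroup which it represents. -/
lemma coveringCon_le_ker (hO : Subgroup.closure O.carrier = ⊤) (H : AdmissibleCollection) :
    coveringCon H O ≤ Con.ker (wordValue hO) := by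
  refine Con.conGen_le.2 ?_
  rintro w w' (⟨g, g', a, b, hg, h1, h2⟩ | ⟨n, p, h, hh, hw⟩)
  · have : g' = conj g ⁅a, b⁆ := Subtype.ext hg
    subst this
    rw [Con.ker_rel, wordValue_eq, wordValue_eq, h1, h2]
    simp [letterValue, letterGenus, XGroup.x_mul, XGroup.toGroup_y]
  · exact wordValue_eq_of_autRel hO (H.admissible n p) hh hw

end CentralQuotient

/-! ### Consequences of the braid relations of `Br_{2,0}` and `Br_{1,1}`. -/

section StrongMonoid

variable {G : Type*} [Group G]

/-- The strong covering semigroup with a unit adjoined. -/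
abbrev StrongMonoid (O : Equipment G) : Type _ := WithOne (StrongCovering O)

namespace StrongMonoid

variable {O : Equipment G}

/-- The generator given by a letter. -/
def gen (l : Letter O) : StrongMonoid O :=
  (Con.toQuotient (FreeSemigroup.of l) : StrongCovering O)

/-- The generator `x_g`. -/
def X (g : O.carrier) : StrongMonoid O := gen (.x g)

/-- The generator `y_{a,b}`. -/
def Y (O : Equipment G) (a b : G) : StrongMonoid O := gen (.y a b)

lemma coe_eq_prod_gen (w : FreeCovering O) :
    ((Con.toQuotient w : StrongCovering O) : StrongMonoid O) = ((letters w).map gen).prod := by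
  induction w using FreeSemigroup.recOnMul with
  | ih1 l => simp [letters, gen]
  | ih2 l w h1 h2 =>
    rw [letters_mul, List.map_append, List.prod_append, ← h1, ← h2]
    rfl

@[elab_as_elim]
lemma induction {C : StrongMonoid O → Prop} (one : C 1) (x : ∀ g, C (X g)) (y : ∀ a b, C (Y O a b))
    (mul : ∀ s t, C s → C t → C (s * t)) (s : StrongMonoid O) : C s := by
  induction s using WithOne.recOneCoe with
  | one => exact one
  | coe s =>
    induction s using Con.induction_on with
    | H w =>
      rw [coe_eq_prod_gen]
      generalize letters w = l
      induction l with
      | nil => exact one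
      | cons a l ih =>
        rw [List.map_cons, List.prod_cons]
        refine mul _ _ ?_ ih
        cases a with
        | x g => exact x g
        | y a b => exact y a b

lemma X_mul_Y (g : O.carrier) (a b : G) : X g * Y O a b = Y O a b * X (conj g ⁅a, b⁆) := by
  have : (Con.toQuotient (FreeSemigroup.of (.x g) * FreeSemigroup.of (.y a b)) :
      StrongCovering O) =
      Con.toQuotient (FreeSemigroup.of (.y a b) * FreeSemigroup.of (.x (conj g ⁅a, b⁆))) :=
    (Con.eq _).2 (ConGen.Rel.of _ _ (Or.inl ⟨g, _, a, b, rfl, rfl, rfl⟩))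
  exact congrArg (WithOne.coe) this

lemma prod_gen_wordOf {n p : ℕ} {h : MulAut (Free n p)} (hh : h ∈ braidGroup n p)
    (f : Free n p →* G) (hf : ∀ i, f (γ i) ∈ O.carrier)
    (hf' : ∀ i, (f.comp h.toMonoidHom) (γ i) ∈ O.carrier) :
    ((wordOf O f hf).map gen).prod = ((wordOf O (f.comp h.toMonoidHom) hf').map gen).prod := by
  -- Both words are empty or neither is; the semigroup relation is needed only in the second case.
  have hlen : (wordOf O f hf).length = (wordOf O (f.comp h.toMonoidHom) hf').length := by
    simp [wordOf]
  rcases hw : wordOf O f hf with _ | ⟨z, l⟩ <;>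
    rcases hw' : wordOf O (f.comp h.toMonoidHom) hf' with _ | ⟨z', l'⟩
  · rfl
  · rw [hw, hw'] at hlen; simp at hlen
  · rw [hw, hw'] at hlen; simp at hlen
  · have : (Con.toQuotient (⟨z, l⟩ : FreeCovering O) : StrongCovering O) =
        Con.toQuotient (⟨z', l'⟩ : FreeCovering O) :=
      (Con.eq _).2 (ConGen.Rel.of _ _ (Or.inr ⟨n, p, h, hh, f, hf, hf', hw.symm, hw'.symm⟩))
    have := congrArg (WithOne.coe) this
    rwa [coe_eq_prod_gen, coe_eq_prod_gen] at this

lemma X_mul_X (g h : O.carrier) : X g * X h = X h * X (conj g (h : G)) := by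
  obtain ⟨e, he⟩ := exists_isSigma (n := 2) (p := 0) 0 1 rfl
  have hmem : e ∈ braidGroup 2 0 := Subgroup.subset_closure (Or.inl (Or.inl (Or.inl ⟨_, _, he⟩)))
  let f : Free 2 0 →* G := FreeGroup.lift fun i => match i with
    | .gam j => if j = 0 then g else h
    | .lam _ => 1
    | .mu _ => 1
  have f0 : f (γ 0) = g := by simp [f, γ]
  have f1 : f (γ 1) = h := by simp [f, γ]
  have e0 : f (e (γ 0)) = h := by rw [he.map_i, f1]
  have e1 : f (e (γ 1)) = conj g (h : G) := by
    rw [he.map_j, map_mul, map_mul, map_inv, f0, f1, coe_conj]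
  have := prod_gen_wordOf (O := O) hmem f
    (Fin.forall_fin_two.2 ⟨f0 ▸ g.2, f1 ▸ h.2⟩)
    (Fin.forall_fin_two.2 ⟨(e0 ▸ h.2 : f (e (γ 0)) ∈ O.carrier),
      (e1 ▸ (conj g (h : G)).2 : f (e (γ 1)) ∈ O.carrier)⟩)
  simpa [wordOf, List.ofFn_succ, f0, f1, e0, e1, X, conj] using this

/-- The natural homomorphism from the structure monoid. -/
def ofX (O : Equipment G) : XMonoid O →* StrongMonoid O := XMonoid.lift X X_mul_X

@[simp] lemma ofX_x (g : O.carrier) : ofX O (XMonoid.x g) = X g := XMonoid.lift_x _ _ _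

lemma X_pow_mul_X (g h : O.carrier) (k : ℕ) :
    X g ^ k * X h = X h * X (conj g (h : G)) ^ k := by
  simpa using congrArg (ofX O) (XMonoid.pow_mul_x g h k)

lemma X_mul_Y_of_mem {h : MulAut (Free 1 1)} (hh : h ∈ braidGroup 1 1) (f : Free 1 1 →* G)
    (g g' : O.carrier) (hg : f (γ 0) = g) (hg' : f (h (γ 0)) = g') :
    X g * Y O (f (lam 0)) (f (mu 0)) = X g' * Y O (f (h (lam 0))) (f (h (mu 0))) := by
  have := prod_gen_wordOf (O := O) hh f (Fin.forall_fin_one.2 (hg ▸ g.2))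
    (Fin.forall_fin_one.2 (hg' ▸ g'.2 : f (h (γ 0)) ∈ O.carrier))
  simpa [wordOf, hg, hg', X, Y] using this

/-- The homomorphism with prescribed values on `γ₁, λ₁, μ₁`. -/
def hom (g a b : G) : Free 1 1 →* G := FreeGroup.lift fun i => match i with
  | .gam _ => g
  | .lam _ => a
  | .mu _ => b

lemma hom_γ (g a b : G) : hom g a b (γ 0) = g := by simp [hom, γ]

lemma hom_lam (g a b : G) : hom g a b (lam 0) = a := by simp [hom, lam]

lemma hom_mu (g a b : G) : hom g a b (mu 0) = b := by simp [hom, mu]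

lemma slid_zero : slid (0 : Fin 1) ((0 : Fin 1) : ℕ) = (γ 0 : Free 1 1) := by
  simp [slid, handles]

lemma X_mul_Y_lam (g : O.carrier) (a b : G) :
    X g * Y O a b = X (conj g (a * b⁻¹ * a⁻¹ * (g : G)⁻¹)) * Y O (g * a) b := by
  obtain ⟨e, he⟩ := exists_isXiLam (n := 1) (p := 1) 0 0 rfl
  have hmem : e ∈ braidGroup 1 1 := Subgroup.subset_closure (Or.inl (Or.inl (Or.inr ⟨_, _, he⟩)))
  have := X_mul_Y_of_mem hmem (hom (g : G) a b) g (conj g (a * b⁻¹ * a⁻¹ * (g : G)⁻¹))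
    (hom_γ _ _ _) (by
      have := he.map_slid
      rw [slid_zero] at this
      simp only [this, map_mul, map_inv, hom_γ, hom_lam, hom_mu, coe_conj])
  rw [he.map_lam_self, he.map_mu, slid_zero] at this
  simpa only [map_mul, hom_γ, hom_lam, hom_mu] using this

lemma X_mul_Y_zeta (g : O.carrier) (a b : G) :
    X g * Y O a b = X (conj g ⁅a, b⁆) * Y O ((conj g ⁅a, b⁆ : G)⁻¹ * a * conj g ⁅a, b⁆)
      ((conj g ⁅a, b⁆ : G)⁻¹ * b * conj g ⁅a, b⁆) := by
  obtain ⟨e, he⟩ := exists_isZeta (n := 1) (p := 1) 0 0 rfl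
  have hmem : e ∈ braidGroup 1 1 := Subgroup.subset_closure (Or.inr ⟨_, _, he⟩)
  have hz : hom (g : G) a b (zetaElt 0 0) = conj g ⁅a, b⁆ := by
    rw [zetaElt, slid_zero]
    simp only [map_mul, map_inv, map_commutatorElement, hom_γ, hom_lam, hom_mu, coe_conj]
  have := X_mul_Y_of_mem hmem (hom (g : G) a b) g (conj g ⁅a, b⁆)
    (hom_γ _ _ _) (by
      have := he.map_slid
      rw [slid_zero] at this
      rw [this, hz])
  rw [he.map_lam_self, he.map_mu_self] at this
  simpa only [map_mul, map_inv, hom_lam, hom_mu, hz] using this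

/-- The `ζ`-relation, with the quasi-free relation used to put its left-hand side in the order `y
x`. -/
lemma Y_mul_X (g : O.carrier) (a b : G) :
    Y O a b * X g = X g * Y O ((g : G)⁻¹ * a * g) ((g : G)⁻¹ * b * g) := by
  have h := X_mul_Y_zeta (conj g ⁅a, b⁆⁻¹) a b
  rwa [X_mul_Y, ← conj_mul, inv_mul_cancel, conj_one] at h

lemma Y_mul_X_mu (g : O.carrier) (a b : G) :
    Y O a b * X g = Y O a ((g : G)⁻¹ * b) * X (conj g (b * a⁻¹ * b⁻¹ * g)) := by
  obtain ⟨e, he⟩ := exists_isXiMu (n := 1) (p := 1) 0 0 rfl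
  have hmem : e ∈ braidGroup 1 1 := Subgroup.subset_closure (Or.inl (Or.inr ⟨_, _, he⟩))
  -- Chosen so that the slid generator, which stands after the handle, maps to `g`; the quasi-free
  -- relation later moves both `x`'s behind the `y`'s.
  set g₀ := conj g ⁅a, b⁆⁻¹ with hg₀
  let f := hom (g₀ : G) a b
  have hs : f (slid 0 (((0 : Fin 1) : ℕ) + 1)) = g := by
    rw [slid_succ, zetaElt, slid_zero]
    simp only [f, map_mul, map_inv, map_commutatorElement, hom_γ, hom_lam, hom_mu, hg₀, coe_conj]
    group
  have hmu : f (e (mu 0)) = (g : G)⁻¹ * b := by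
    rw [he.map_mu_self, map_mul, map_inv, hs, hom_mu]
  have hlam : f (e (lam 0)) = a := by rw [he.map_lam, hom_lam]
  have hγ : f (e (γ 0)) = conj (conj g (b * a⁻¹ * b⁻¹ * g)) ⁅a, (g : G)⁻¹ * b⁆⁻¹ := by
    have h1 : f (e (slid 0 (((0 : Fin 1) : ℕ) + 1))) = conj g (b * a⁻¹ * b⁻¹ * g) := by
      rw [he.map_slid]
      simp only [map_mul, map_inv, hs, coe_conj]
      simp only [f, hom_lam, hom_mu]
    rw [slid_succ, zetaElt, slid_zero] at h1
    simp only [map_mul, map_inv, map_commutatorElement, hlam, hmu] at h1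
    rw [coe_conj, ← h1]
    group
  have := X_mul_Y_of_mem hmem f g₀ _ (hom_γ _ _ _) hγ
  rw [hlam, hmu, hom_lam, hom_mu, X_mul_Y, X_mul_Y, hg₀, ← conj_mul, ← conj_mul, inv_mul_cancel,
    inv_mul_cancel, conj_one, conj_one] at this
  exact this

/-- Iterating the `ξ_λ`-relation conjugates all `k` copies of `x_g` by one common element. For `k =
|G|` the handle is unchanged, and only the index of `Z g` is conjugated (`Z_mul_Y_lam`). -/
lemma X_pow_mul_Y (g : O.carrier) (a b : G) (k : ℕ) :
    X g ^ k * Y O a b =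
      X (conj g (a * b⁻¹ * a⁻¹ * ((g : G) ^ k)⁻¹)) ^ k * Y O ((g : G) ^ k * a) b := by
  induction k with
  | zero => simp
  | succ k ih =>
    set q := conj g (a * b⁻¹ * a⁻¹ * ((g : G) ^ (k + 1))⁻¹) with hq
    have h1 : conj g (a * b⁻¹ * a⁻¹ * ((g : G) ^ k)⁻¹) = conj q (g : G) := by
      rw [hq, ← conj_mul]; congr 1; group
    have h3 : conj g ((g : G) ^ k * a * b⁻¹ * ((g : G) ^ k * a)⁻¹ * (g : G)⁻¹) = q := by
      refine Subtype.ext ?_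
      rw [hq, coe_conj, coe_conj, pow_succ']
      group
    rw [pow_succ', mul_assoc, ih, h1, ← mul_assoc, ← X_pow_mul_X, mul_assoc, X_mul_Y_lam, h3, ← mul_assoc,
      ← pow_succ, ← mul_assoc, ← pow_succ']

lemma Y_mul_X_pow_mu (g : O.carrier) (a b : G) (k : ℕ) :
    Y O a b * X g ^ k =
      Y O a (((g : G) ^ k)⁻¹ * b) * X (conj g (b * a⁻¹ * b⁻¹ * (g : G) ^ k)) ^ k := by
  induction k with
  | zero => simp
  | succ k ih =>
    set q := conj g (b * a⁻¹ * b⁻¹ * (g : G) ^ k) with hq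
    have h1 : conj g (b * a⁻¹ * b⁻¹ * (g : G) ^ (k + 1)) = conj q (g : G) := by
      rw [hq, ← conj_mul, pow_succ]; congr 1; group
    have h3 : conj g (((g : G) ^ k)⁻¹ * b * a⁻¹ * (((g : G) ^ k)⁻¹ * b)⁻¹ * g) = conj q (g : G) := by
      refine Subtype.ext ?_
      simp only [hq, coe_conj]
      group
    rw [pow_succ (X g), ← mul_assoc, ih, mul_assoc, X_pow_mul_X, ← mul_assoc, Y_mul_X_mu, h3, mul_assoc,
      ← pow_succ', h1, ← mul_assoc, ← mul_inv_rev, ← pow_succ]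

lemma Y_mul_X_pow (g : O.carrier) (a b : G) (k : ℕ) :
    Y O a b * X g ^ k =
      X g ^ k * Y O (((g : G) ^ k)⁻¹ * a * g ^ k) (((g : G) ^ k)⁻¹ * b * g ^ k) := by
  induction k with
  | zero => simp
  | succ k ih =>
    rw [pow_succ, ← mul_assoc, ih, mul_assoc, Y_mul_X, ← mul_assoc]
    congr 2 <;> group

lemma X_pow_mul_Y_comm (g : O.carrier) (a b : G) (k : ℕ) :
    X g ^ k * Y O a b = Y O a b * X (conj g ⁅a, b⁆) ^ k := by
  induction k with
  | zero => simp
  | succ k ih => rw [pow_succ, mul_assoc, X_mul_Y, ← mul_assoc, ih, mul_assoc, pow_succ]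

/-- The image of `z_g`. -/
noncomputable def Z (g : O.carrier) : StrongMonoid O := X g ^ Nat.card G

@[simp] lemma ofX_z (g : O.carrier) : ofX O (XMonoid.z g) = Z g := by
  rw [XMonoid.z, map_pow, ofX_x, Z]

lemma Z_mul_Y_comm (g : O.carrier) (a b : G) : Z g * Y O a b = Y O a b * Z g := by
  simp [Z, Y_mul_X_pow]

lemma Z_mul_Y_commutator (g : O.carrier) (a b : G) :
    Z g * Y O a b = Z (conj g ⁅a, b⁆) * Y O a b := by
  rw [Z_mul_Y_comm (conj g _), Z, X_pow_mul_Y_comm, Z]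

lemma Z_mul_Y_lam (g : O.carrier) (a b : G) :
    Z g * Y O a b = Z (conj g (a * b⁻¹ * a⁻¹)) * Y O a b := by
  simpa [Z] using X_pow_mul_Y g a b (Nat.card G)

lemma Z_mul_Y_mu (g : O.carrier) (a b : G) :
    Z g * Y O a b = Z (conj g (b * a⁻¹ * b⁻¹)) * Y O a b := by
  rw [Z_mul_Y_comm, Z_mul_Y_comm]
  simpa [Z] using Y_mul_X_pow_mu g a b (Nat.card G)

lemma Z_comm (g : O.carrier) (s : StrongMonoid O) : Z g * s = s * Z g := by
  induction s using induction with
  | one => simp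
  | x h => rw [← ofX_x, ← ofX_z, ← map_mul, XMonoid.z_comm, map_mul]
  | y a b => exact Z_mul_Y_comm g a b
  | mul s t hs ht => rw [← mul_assoc, hs, mul_assoc, ht, mul_assoc]

lemma Z_mul_X (g h : O.carrier) : Z g * X h = Z (conj g (h : G)) * X h := by
  rw [Z_comm (conj g _), ← ofX_x, ← ofX_z, ← ofX_z, ← map_mul, XMonoid.z_mul_x, map_mul]

end StrongMonoid

end StrongMonoid

/-! ### Products of central powers up to conjugacy of their indices. -/

section MoreXMonoid

variable {G : Type*} [Group G] {O : Equipment G}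

namespace XMonoid

lemma zprod_perm {l l' : List O.carrier} (h : l.Perm l') : zprod l = zprod l' := by
  induction h with
  | nil => rfl
  | cons g _ ih => rw [zprod_cons, zprod_cons, ih]
  | swap g g' l => simp only [zprod_cons]; rw [← mul_assoc, z_comm, mul_assoc]
  | trans _ _ h h' => rw [h, h']

lemma exists_mul_z_eq_zprod {g : O.carrier} {l : List O.carrier} (hg : g ∈ l) :
    ∃ w, w * z g = zprod l := by
  have : DecidableEq O.carrier := Classical.decEq _
  exact ⟨zprod (l.erase g), by rw [zprod_perm (List.perm_cons_erase hg), zprod_cons, z_comm]⟩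

variable [Finite G]

/-- The product of all `z_g`. -/
noncomputable def zAll (O : Equipment G) : XMonoid O :=
  zprod (Set.toFinite (Set.univ : Set O.carrier)).toFinset.toList

lemma exists_mul_z_eq_zAll (g : O.carrier) : ∃ w, w * z g = zAll O :=
  exists_mul_z_eq_zprod (by simp)

/-- Completes an arbitrary product of `z`'s to a power of the single element `zAll O`, to which
`exists_uniform_pow` applies. -/
lemma exists_mul_zprod_eq_pow (l : List O.carrier) : ∃ w n, w * zprod l = zAll O ^ n := by
  induction l with
  | nil => exact ⟨1, 0, by simp⟩
  | cons g l ih =>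
    obtain ⟨w, n, h⟩ := ih
    obtain ⟨w', h'⟩ := exists_mul_z_eq_zAll g
    refine ⟨w' * w, n + 1, ?_⟩
    rw [zprod_cons, z_comm, mul_assoc, ← mul_assoc w, h, ← z_comm, ← mul_assoc, h', pow_succ']

/-- `zAll O` is divisible by `x_h`, and next to `x_h` the elements `z_g` and `z_{g^h}` agree. -/
lemma zAll_mul_z_conj_of_mem (g h : O.carrier) :
    zAll O * z g = zAll O * z (conj g (h : G)) := by
  obtain ⟨w, hw⟩ := exists_mul_z_eq_zAll h
  have : zAll O = w * x h ^ (Nat.card G - 1) * x h := by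
    rw [← hw, mul_assoc, ← pow_succ, Nat.sub_add_cancel Nat.card_pos, z]
  rw [this, mul_assoc _ (x h) (z (conj _ _)), ← z_mul_x, ← z_comm, ← mul_assoc _ (z g), ← z_comm g (w * _),
    mul_assoc (z g)]

lemma exists_monoidToGroup_eq (hO : Subgroup.closure O.carrier = ⊤) (h : G) :
    ∃ m, XGroup.monoidToGroup O m = h := by
  obtain ⟨u, rfl⟩ := XGroup.toGroup_surjective hO h
  obtain ⟨m, rfl⟩ := XGroup.ofMonoid_surjective u
  exact ⟨m, rfl⟩

lemma zAll_mul_z_conj (hO : Subgroup.closure O.carrier = ⊤) (g : O.carrier) (h : G) :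
    zAll O * z g = zAll O * z (conj g h) := by
  obtain ⟨m, rfl⟩ := exists_monoidToGroup_eq hO h
  induction m using induction generalizing g with
  | one => simp
  | mul k m ih =>
    rw [map_mul, conj_mul, ← ih, zAll_mul_z_conj_of_mem g k]
    simp [XGroup.monoidToGroup]

end XMonoid

lemma Equipment.exists_index (g : O.carrier) : ∃ i, ConjClasses.mk (g : G) = O.cls i := g.2

/-- The index of the conjugacy class of an element of `O`. -/
noncomputable def index (g : O.carrier) : Fin O.m := (O.exists_index g).choose

lemma mk_eq_cls_iff (g : O.carrier) (i : Fin O.m) :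
    ConjClasses.mk (g : G) = O.cls i ↔ index g = i := by
  have h : ConjClasses.mk (g : G) = O.cls (index g) := (O.exists_index g).choose_spec
  exact ⟨fun h' => O.cls_injective (h.symm.trans h'), fun h' => h' ▸ h⟩

lemma exists_conj_of_index_eq {g g' : O.carrier} (h : index g = index g') :
    ∃ k, g' = conj g k := by
  rw [← mk_eq_cls_iff, ← (mk_eq_cls_iff g' _).2 rfl, ConjClasses.mk_eq_mk_iff_isConj] at h
  obtain ⟨c, hc⟩ := isConj_iff.1 h
  exact ⟨c⁻¹, Subtype.ext (by rw [coe_conj, inv_inv, hc])⟩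

lemma exists_index_eq (i : Fin O.m) : ∃ g : O.carrier, index g = i := by
  obtain ⟨g, hg⟩ := ConjClasses.exists_rep (O.cls i)
  exact ⟨⟨g, i, hg⟩, (mk_eq_cls_iff _ _).1 hg⟩

/-- Since `O` generates `G`, in the presence of `zAll O` each `z_g` may be replaced by that of a
fixed representative of its class. -/
lemma zAll_mul_zprod_eq [Finite G] (hO : Subgroup.closure O.carrier = ⊤) {l l' : List O.carrier}
    (h : (l.map index).Perm (l'.map index)) :
    XMonoid.zAll O * XMonoid.zprod l = XMonoid.zAll O * XMonoid.zprod l' := by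
  choose rep hrep using exists_index_eq (O := O)
  have key : ∀ l : List O.carrier, XMonoid.zAll O * XMonoid.zprod l =
      XMonoid.zAll O * XMonoid.zprod ((l.map index).map rep) := by
    intro l
    induction l with
    | nil => rfl
    | cons g l ih =>
      obtain ⟨k, hk⟩ := exists_conj_of_index_eq (hrep (index g)).symm
      rw [List.map_cons, List.map_cons, XMonoid.zprod_cons, XMonoid.zprod_cons, ← mul_assoc,
        ← mul_assoc, hk, ← XMonoid.zAll_mul_z_conj hO, ← XMonoid.z_comm, mul_assoc, ih, mul_assoc]
  rw [key l, key l', XMonoid.zprod_perm (h.map rep)]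

end MoreXMonoid

/-! ### Types, conjugation of central factors, and extraction of such factors. -/

namespace StrongMonoid

variable {G : Type*} [Group G] {O : Equipment G}

/-- The type of an element. -/
noncomputable def type (s : StrongMonoid O) : Fin O.m → ℕ := WithOne.recOneCoe 0 typ s

/-- The subgroup generated by the elements indexing the factors of `s`. -/
def group (s : StrongMonoid O) : Subgroup G := WithOne.recOneCoe ⊥ grpOf s

@[simp] lemma type_one : type (1 : StrongMonoid O) = 0 := rfl

lemma type_mul (s t : StrongMonoid O) : type (s * t) = type s + type t := by
  induction s using WithOne.recOneCoe with
  | one => simp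
  | coe s =>
    induction t using WithOne.recOneCoe with
    | one => simp
    | coe t => exact typ_mul s t

@[simp] lemma group_one : group (1 : StrongMonoid O) = ⊥ := rfl

lemma group_mul (s t : StrongMonoid O) : group (s * t) = group s ⊔ group t := by
  induction s using WithOne.recOneCoe with
  | one => simp
  | coe s =>
    induction t using WithOne.recOneCoe with
    | one => simp
    | coe t => exact grpOf_mul s t

lemma type_X (g : O.carrier) (i : Fin O.m) : type (X g) i = if index g = i then 1 else 0 := by
  change ([letterType (Letter.x g)].sum) i = _
  simp [letterType, mk_eq_cls_iff]

@[simp] lemma type_Y (a b : G) : type (Y O a b) = 0 := by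
  change ([letterType (Letter.y a b)].sum) = _
  simp [letterType]

lemma group_X (g : O.carrier) : group (X g) = Subgroup.closure {(g : G)} := by
  change Subgroup.closure {c | ∃ z ∈ [Letter.x g], c ∈ letterSet z} = _
  simp [letterSet]

lemma group_Y (a b : G) : group (Y O a b) = Subgroup.closure {a, b} := by
  change Subgroup.closure {c | ∃ z ∈ [Letter.y a b], c ∈ letterSet z} = _
  congr 1
  ext
  simp [letterSet]

lemma type_pow (s : StrongMonoid O) (k : ℕ) : type (s ^ k) = k • type s := by
  induction k with
  | zero => simp
  | succ k ih => rw [pow_succ, type_mul, ih, succ_nsmul]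

lemma group_pow_succ (s : StrongMonoid O) (k : ℕ) : group (s ^ (k + 1)) = group s := by
  induction k with
  | zero => simp
  | succ k ih => rw [pow_succ, group_mul, ih, sup_idem]

lemma type_ofX_zprod (l : List O.carrier) (i : Fin O.m) :
    type (ofX O (XMonoid.zprod l)) i = Nat.card G * (l.map index).count i := by
  induction l with
  | nil => simp
  | cons g l ih =>
    rw [XMonoid.zprod_cons, map_mul, ofX_z, Z, type_mul, type_pow, Pi.add_apply, ih,
      Pi.smul_apply, type_X, List.map_cons, List.count_cons]
    by_cases h : index g = i <;> simp [h, mul_add, add_comm]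

lemma type_ofX_xprod (l : List O.carrier) (i : Fin O.m) :
    type (ofX O (XMonoid.xprod l)) i = (l.filter (index · = i)).length := by
  induction l with
  | nil => simp
  | cons g l ih =>
    rw [XMonoid.xprod_cons, map_mul, ofX_x, type_mul, Pi.add_apply, ih, type_X, List.filter_cons]
    by_cases h : index g = i <;> simp [h, add_comm]

/-- The subgroup of all `h ∈ G` such that replacing `g` by `g^h` does not change the product of
`x_g ^ |G|` and `s`. -/
def stabilizer (s : StrongMonoid O) : Subgroup G where
  carrier := {h | ∀ g : O.carrier, Z g * s = Z (conj g h) * s}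
  one_mem' g := by simp
  mul_mem' {h k} hh hk g := by rw [conj_mul, ← hk, ← hh]
  inv_mem' {h} hh g := by rw [hh (conj g h⁻¹), ← conj_mul, inv_mul_cancel, conj_one]

lemma group_le_stabilizer (s : StrongMonoid O) : group s ≤ stabilizer s := by
  induction s using induction with
  | one => simp
  | x h =>
    rw [group_X, Subgroup.closure_le, Set.singleton_subset_iff]
    exact fun g => Z_mul_X g h
  | y a b =>
    have h1 : ⁅a, b⁆ ∈ stabilizer (Y O a b) := fun g => Z_mul_Y_commutator g a b
    have h2 : a * b⁻¹ * a⁻¹ ∈ stabilizer (Y O a b) := fun g => Z_mul_Y_lam g a b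
    have h3 : b * a⁻¹ * b⁻¹ ∈ stabilizer (Y O a b) := fun g => Z_mul_Y_mu g a b
    -- `b⁻¹ = (a b⁻¹ a⁻¹) [a, b]`, and then `a⁻¹ = b⁻¹ (b a⁻¹ b⁻¹) b`.
    have hb : b ∈ stabilizer (Y O a b) := by
      have := (stabilizer (Y O a b)).inv_mem ((stabilizer (Y O a b)).mul_mem h2 h1)
      rw [commutatorElement_def] at this
      convert this using 1
      group
    have ha : a ∈ stabilizer (Y O a b) := by
      have := (stabilizer (Y O a b)).inv_mem ((stabilizer (Y O a b)).mul_mem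
        ((stabilizer (Y O a b)).mul_mem ((stabilizer (Y O a b)).inv_mem hb) h3) hb)
      convert this using 1
      group
    rw [group_Y, Subgroup.closure_le, Set.insert_subset_iff, Set.singleton_subset_iff]
    exact ⟨ha, hb⟩
  | mul s t hs ht =>
    rw [group_mul, sup_le_iff]
    refine ⟨hs.trans fun h hh g => ?_, ht.trans fun h hh g => ?_⟩
    · rw [← mul_assoc, ← mul_assoc, hh g]
    · rw [← mul_assoc, Z_comm, mul_assoc, hh g, ← mul_assoc, ← Z_comm, mul_assoc]

section Extraction

variable [Finite G]

/-- A type with all entries above this bound forces repetitions among the factors `x_g`. -/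
noncomputable def bound (O : Equipment G) : ℕ := Nat.card O.carrier * Nat.card G

/-- By pigeonhole some conjugate `g'` of `g` occurs more than `|G|` times, so `Z g'` splits off. The
rest still generates `G`, hence `Z g'` may be replaced by `Z g`. -/
lemma exists_eq_Z_mul {m : XMonoid O} {y : StrongMonoid O} (hy : type y = 0)
    (hs : group (ofX O m * y) = ⊤) (g : O.carrier)
    (hb : bound O < type (ofX O m * y) (index g)) :
    ∃ m', ofX O m * y = Z g * (ofX O m' * y) ∧ group (ofX O m' * y) = ⊤ := by
  have : DecidableEq O.carrier := Classical.decEq _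
  have := Fintype.ofFinite O.carrier
  obtain ⟨l, rfl⟩ := XMonoid.exists_xprod m
  rw [type_mul, hy, add_zero, type_ofX_xprod, bound, Nat.card_eq_fintype_card] at hb
  obtain ⟨g', hg'⟩ := exists_lt_count _ _ hb
  have hmem := List.count_pos_iff.1 (Nat.zero_lt_of_lt hg')
  have hindex : index g' = index g := by simpa using (List.mem_filter.1 hmem).2
  obtain ⟨k, rfl⟩ := exists_conj_of_index_eq hindex
  have hcount : Nat.card G < l.count g' := hg'.trans_le (List.filter_sublist.count_le _)
  obtain ⟨l', hl', -⟩ := XMonoid.exists_xprod_eq_pow_mul g' l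
  -- The strict inequality leaves `n + 1 ≥ 1` copies of `x_{g'}` behind, so the subgroup generated
  -- does not shrink.
  obtain ⟨n, hn⟩ := Nat.exists_eq_add_of_lt hcount
  have e : ofX O (XMonoid.xprod l) * y =
      Z g' * (ofX O (XMonoid.x g' ^ (n + 1) * XMonoid.xprod l') * y) := by
    rw [hl', hn, add_assoc, pow_add, ← ofX_z, mul_assoc, map_mul, mul_assoc]
    rfl
  have hgr : group (ofX O (XMonoid.x g' ^ (n + 1) * XMonoid.xprod l') * y) = ⊤ := by
    rw [← hs, hl', hn, map_mul, map_mul, map_pow, map_pow, group_mul, group_mul, group_mul,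
      group_mul, ofX_x, group_pow_succ, group_pow_succ]
  refine ⟨_, ?_, hgr⟩
  rw [e]
  exact group_le_stabilizer _ (hgr ▸ Subgroup.mem_top k) g'

/-- The type hypothesis reserves `bound O` on top of the type of the product to be extracted, so
each successive extraction remains possible. -/
lemma exists_eq_zprod_mul (l : List O.carrier) {m : XMonoid O} {y : StrongMonoid O}
    (hy : type y = 0) (hs : group (ofX O m * y) = ⊤)
    (hb : ∀ i, bound O + type (ofX O (XMonoid.zprod l)) i < type (ofX O m * y) i) :
    ∃ m', ofX O m * y = ofX O (XMonoid.zprod l) * (ofX O m' * y) := by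
  induction l generalizing m with
  | nil => exact ⟨m, by simp⟩
  | cons g l ih =>
    obtain ⟨m', h1, h2⟩ := exists_eq_Z_mul hy hs g ((Nat.le_add_right _ _).trans_lt (hb _))
    obtain ⟨m'', h3⟩ := ih h2 fun i => by
      have := hb i
      rw [XMonoid.zprod_cons, map_mul, ofX_z, type_mul, h1, type_mul (Z g), Pi.add_apply,
        Pi.add_apply] at this
      omega
    exact ⟨m'', by rw [h1, h3, XMonoid.zprod_cons, map_mul, ofX_z, mul_assoc]⟩

end Extraction

lemma exists_Y_mul_ofX (a b : G) (v : XMonoid O) :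
    ∃ v', Y O a b * ofX O v = ofX O v' * Y O a b := by
  induction v using XMonoid.induction with
  | one => exact ⟨1, by simp⟩
  | mul g v ih =>
    obtain ⟨v', h⟩ := ih
    refine ⟨XMonoid.x (conj g ⁅a, b⁆⁻¹) * v', ?_⟩
    rw [map_mul, map_mul, ofX_x, ofX_x, mul_assoc, ← h, ← mul_assoc, ← mul_assoc, X_mul_Y,
      ← conj_mul, inv_mul_cancel, conj_one]

/-- The product of the `y_{a,b}` over a list of pairs. -/
def yprod (O : Equipment G) (ys : List (G × G)) : StrongMonoid O :=
  (ys.map fun p => Y O p.1 p.2).prod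

@[simp] lemma yprod_nil : yprod O [] = 1 := rfl

@[simp] lemma yprod_cons (p : G × G) (ys : List (G × G)) :
    yprod O (p :: ys) = Y O p.1 p.2 * yprod O ys := by simp [yprod]

lemma yprod_append (ys ys' : List (G × G)) : yprod O (ys ++ ys') = yprod O ys * yprod O ys' := by
  simp [yprod]

@[simp] lemma type_yprod (ys : List (G × G)) : type (yprod O ys) = 0 := by
  induction ys with
  | nil => simp
  | cons p ys ih => simp [type_mul, ih]

lemma exists_yprod_mul_ofX (ys : List (G × G)) (v : XMonoid O) :
    ∃ v', yprod O ys * ofX O v = ofX O v' * yprod O ys := by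
  induction ys with
  | nil => exact ⟨v, by simp⟩
  | cons p ys ih =>
    obtain ⟨v', h⟩ := ih
    obtain ⟨v'', h'⟩ := exists_Y_mul_ofX p.1 p.2 v'
    exact ⟨v'', by rw [yprod_cons, mul_assoc, h, ← mul_assoc, h', mul_assoc]⟩

lemma exists_eq_ofX_mul_yprod (s : StrongMonoid O) : ∃ m ys, s = ofX O m * yprod O ys := by
  induction s using induction with
  | one => exact ⟨1, [], by simp⟩
  | x g => exact ⟨XMonoid.x g, [], by simp⟩
  | y a b => exact ⟨1, [(a, b)], by simp⟩
  | mul s t hs ht =>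
    obtain ⟨m, ys, rfl⟩ := hs
    obtain ⟨m', ys', rfl⟩ := ht
    obtain ⟨v, hv⟩ := exists_yprod_mul_ofX ys m'
    refine ⟨m * v, ys ++ ys', ?_⟩
    rw [mul_assoc, ← mul_assoc (yprod O ys), hv, map_mul, yprod_append]
    simp only [mul_assoc]

lemma Y_one_mul_ofX (m : XMonoid O) : Y O 1 1 * ofX O m = ofX O m * Y O 1 1 := by
  induction m using XMonoid.induction with
  | one => simp
  | mul g m ih =>
    have : X g * Y O 1 1 = Y O 1 1 * X g := by
      rw [X_mul_Y, commutatorElement_self, conj_one]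
    rw [map_mul, ofX_x, ← mul_assoc, ← this, mul_assoc, ih, mul_assoc]

lemma Y_one_pow_mul_ofX (k : ℕ) (m : XMonoid O) :
    Y O 1 1 ^ k * ofX O m = ofX O m * Y O 1 1 ^ k := by
  induction k with
  | zero => simp
  | succ k ih => rw [pow_succ, mul_assoc, Y_one_mul_ofX, ← mul_assoc, ih, mul_assoc]

/-! ### Trivialising the handles and separating elements of large type. -/

section Reduction

variable [Finite G]

/-- One copy of `x_g` is taken from `Z g` and used in the `ξ_λ`-relation, which multiplies `a` by
`g`. The other `|G| - 1` copies and the new `x` go into `v`. -/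
lemma exists_zprod_mul_Y_lam (m : XMonoid O) (a b : G) :
    ∃ l v, ofX O (XMonoid.zprod l) * Y O a b =
      ofX O v * Y O (XGroup.monoidToGroup O m * a) b := by
  induction m using XMonoid.induction with
  | one => exact ⟨[], 1, by simp⟩
  | mul g m ih =>
    obtain ⟨l, v, h⟩ := ih
    have hZ : ∀ a, ∃ v, Z g * Y O a b = ofX O v * Y O (g * a) b := fun a => by
      refine ⟨XMonoid.x g ^ (Nat.card G - 1) *
        XMonoid.x (conj g (a * b⁻¹ * a⁻¹ * (g : G)⁻¹)), ?_⟩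
      rw [map_mul, ofX_x, mul_assoc, ← X_mul_Y_lam, map_pow, ofX_x, ← mul_assoc, ← pow_succ,
        Nat.sub_add_cancel Nat.card_pos, Z]
    obtain ⟨v', h'⟩ := hZ (XGroup.monoidToGroup O m * a)
    refine ⟨g :: l, v * v', ?_⟩
    rw [XMonoid.zprod_cons, map_mul, mul_assoc, h, ofX_z, ← mul_assoc, Z_comm, mul_assoc, h',
      map_mul, map_mul, mul_assoc, mul_assoc]
    simp [XGroup.monoidToGroup]

lemma exists_zprod_mul_Y_mu (m : XMonoid O) (a b : G) :
    ∃ l v, ofX O (XMonoid.zprod l) * Y O a b =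
      ofX O v * Y O a ((XGroup.monoidToGroup O m)⁻¹ * b) := by
  induction m using XMonoid.induction generalizing b with
  | one => exact ⟨[], 1, by simp⟩
  | mul g m ih =>
    -- Here `g` acts before `m`, because `(g m)⁻¹ b = m⁻¹ (g⁻¹ b)`.
    obtain ⟨l, v, h⟩ := ih ((g : G)⁻¹ * b)
    obtain ⟨v', h'⟩ : ∃ v, Z g * Y O a b = ofX O v * Y O a ((g : G)⁻¹ * b) := by
      obtain ⟨v, hv⟩ := exists_Y_mul_ofX a ((g : G)⁻¹ * b)
        (XMonoid.x (conj g (b * a⁻¹ * b⁻¹ * g)) * XMonoid.x g ^ (Nat.card G - 1))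
      refine ⟨v, ?_⟩
      rw [← hv, map_mul, ofX_x, ← mul_assoc, ← Y_mul_X_mu, map_pow, ofX_x, mul_assoc, ← pow_succ',
        Nat.sub_add_cancel Nat.card_pos, ← Z, Z_comm]
    refine ⟨g :: l, v' * v, ?_⟩
    rw [XMonoid.zprod_cons, XMonoid.z_comm, map_mul, mul_assoc, ofX_z, h', ← mul_assoc, ← map_mul,
      XMonoid.zprod_comm, map_mul, mul_assoc, h, map_mul, map_mul, mul_inv_rev, mul_assoc,
      mul_assoc]
    simp [XGroup.monoidToGroup]

lemma exists_zprod_mul_Y (hO : Subgroup.closure O.carrier = ⊤) (a b : G) :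
    ∃ l v, ofX O (XMonoid.zprod l) * Y O a b = ofX O v * Y O 1 1 := by
  -- The `λ`-move multiplies `a` by `a⁻¹`, the `μ`-move then multiplies `b` by `b⁻¹`; this is where
  -- `O` must generate `G`.
  obtain ⟨m, hm⟩ := XMonoid.exists_monoidToGroup_eq hO a⁻¹
  obtain ⟨m', hm'⟩ := XMonoid.exists_monoidToGroup_eq hO b
  obtain ⟨l, v, h⟩ := exists_zprod_mul_Y_lam m a b
  obtain ⟨l', v', h'⟩ := exists_zprod_mul_Y_mu m' 1 b
  rw [hm, inv_mul_cancel] at h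
  rw [hm', inv_mul_cancel] at h'
  refine ⟨l' ++ l, v * v', ?_⟩
  rw [XMonoid.zprod_append, map_mul, mul_assoc, h, ← mul_assoc, ← map_mul, XMonoid.zprod_comm,
    map_mul, mul_assoc, h', map_mul, mul_assoc]

/-- Elements of large type with `G_s = G` are products of an element of the structure monoid and a
power of `y_{1,1}`. -/
lemma exists_eq_ofX_mul_Y_one_pow (hO : Subgroup.closure O.carrier = ⊤) :
    ∃ T : Fin O.m → ℕ, ∀ s : StrongMonoid O, group s = ⊤ → (∀ i, T i < type s i) →
      ∃ m k, s = ofX O m * Y O 1 1 ^ k := by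
  have := Fintype.ofFinite G
  choose L v hL using exists_zprod_mul_Y hO
  -- Enough to extract the `z`'s needed for any single pair. No accumulation over the handles is
  -- needed: each step only rewrites the same `s`, so its type never decreases.
  refine ⟨fun i => bound O + ∑ p : G × G, type (ofX O (XMonoid.zprod (L p.1 p.2))) i,
    fun s hs hT => ?_⟩
  suffices h : ∀ (ys : List (G × G)) (m : XMonoid O) (k : ℕ),
      s = ofX O m * (Y O 1 1 ^ k * yprod O ys) → ∃ m k, s = ofX O m * Y O 1 1 ^ k by
    obtain ⟨m, ys, h'⟩ := exists_eq_ofX_mul_yprod s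
    exact h ys m 0 (by simpa using h')
  intro ys
  induction ys with
  | nil => exact fun m k h => ⟨m, k, by simpa using h⟩
  | cons p ys ih =>
    intro m k h
    obtain ⟨m', hm'⟩ := exists_eq_zprod_mul (L p.1 p.2) (m := m)
      (y := Y O 1 1 ^ k * yprod O (p :: ys)) (by simp [type_mul, type_pow]) (h ▸ hs) fun i => by
        rw [← h]
        refine lt_of_le_of_lt ?_ (hT i)
        have := Finset.single_le_sum
          (f := fun p : G × G => type (ofX O (XMonoid.zprod (L p.1 p.2))) i)
          (fun _ _ => Nat.zero_le _) (Finset.mem_univ p)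
        exact Nat.add_le_add_left this _
    refine ih (m' * v p.1 p.2) (k + 1) ?_
    have e1 : ofX O (XMonoid.zprod (L p.1 p.2)) * (ofX O m' * Y O 1 1 ^ k) =
        ofX O m' * Y O 1 1 ^ k * ofX O (XMonoid.zprod (L p.1 p.2)) := by
      rw [← mul_assoc, ← map_mul, XMonoid.zprod_comm, map_mul, mul_assoc, ← Y_one_pow_mul_ofX,
        mul_assoc]
    calc s = ofX O (XMonoid.zprod (L p.1 p.2)) * (ofX O m' * Y O 1 1 ^ k) *
          (Y O p.1 p.2 * yprod O ys) := by rw [h, hm', yprod_cons]; simp only [mul_assoc]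
      _ = ofX O m' * Y O 1 1 ^ k * (ofX O (XMonoid.zprod (L p.1 p.2)) * Y O p.1 p.2) *
          yprod O ys := by rw [e1]; simp only [mul_assoc]
      _ = ofX O m' * (Y O 1 1 ^ k * ofX O (v p.1 p.2)) * Y O 1 1 * yprod O ys := by
        rw [hL]; simp only [mul_assoc]
      _ = _ := by rw [Y_one_pow_mul_ofX, map_mul, pow_succ]; simp only [mul_assoc]

/-- The value of an element in the group `XGroup O`, together with its number of handles. -/
noncomputable def value (hO : Subgroup.closure O.carrier = ⊤) :
    StrongMonoid O →* XGroup O × Multiplicative ℕ :=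
  WithOne.lift
    { toFun := fun s => Con.liftOn s (wordValue hO) fun _ _ h => coveringCon_le_ker hO _ h
      map_mul' := fun s t => by
        induction s using Con.induction_on
        induction t using Con.induction_on
        exact map_mul (wordValue hO) _ _ }

lemma value_X (hO : Subgroup.closure O.carrier = ⊤) (g : O.carrier) :
    value hO (X g) = (XGroup.x g, 1) := rfl

lemma value_Y_one (hO : Subgroup.closure O.carrier = ⊤) :
    value hO (Y O 1 1) = (1, Multiplicative.ofAdd 1) := by
  rw [← XGroup.y_one hO]
  rfl

lemma value_ofX (hO : Subgroup.closure O.carrier = ⊤) (m : XMonoid O) :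
    value hO (ofX O m) = (XGroup.ofMonoid O m, 1) := by
  induction m using XMonoid.induction with
  | one => simp only [map_one]; rfl
  | mul g m ih => rw [map_mul, map_mul, ih, ofX_x, value_X, map_mul]; simp [XGroup.x]

/-- On elements of large type with `G_s = G` the type and the value are complete invariants. -/
theorem eq_of_value_eq (hO : Subgroup.closure O.carrier = ⊤) :
    ∃ T : Fin O.m → ℕ, ∀ s t : StrongMonoid O, group s = ⊤ → group t = ⊤ →
      (∀ i, T i < type s i) → type s = type t → value hO s = value hO t → s = t := by
  obtain ⟨K, hK⟩ := XMonoid.exists_uniform_pow (XMonoid.zAll O)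
  obtain ⟨T, hT⟩ := exists_eq_ofX_mul_Y_one_pow hO
  -- Of the `K + 1` factors `zAll O`, one makes products of `z`'s depend only on classes, and the
  -- other `K` serve the cancellation.
  obtain ⟨L, hL⟩ : ∃ L, XMonoid.zAll O ^ (K + 1) = XMonoid.zprod L :=
    ⟨_, (XMonoid.zprod_replicate_flatten _ _).symm⟩
  refine ⟨fun i => T i + bound O + type (ofX O (XMonoid.zprod L)) i,
    fun s t hs ht hTs hst hval => ?_⟩
  have key : ∀ s : StrongMonoid O, group s = ⊤ →
      (∀ i, T i + bound O + type (ofX O (XMonoid.zprod L)) i < type s i) →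
      ∃ m k, s = ofX O (XMonoid.zprod L * m) * Y O 1 1 ^ k := by
    intro s hs hTs
    obtain ⟨m, k, rfl⟩ := hT s hs fun i => by have := hTs i; omega
    obtain ⟨m', hm'⟩ := exists_eq_zprod_mul L (m := m) (y := Y O 1 1 ^ k) (by simp [type_pow]) hs
      fun i => by have := hTs i; omega
    exact ⟨m', k, by rw [hm', map_mul, mul_assoc]⟩
  obtain ⟨m, k, rfl⟩ := key s hs hTs
  obtain ⟨m', k', rfl⟩ := key t ht (hst ▸ hTs)
  simp only [map_mul (value hO), map_pow, value_ofX, value_Y_one, Prod.mk.injEq, Prod.pow_mk,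
    Prod.mk_mul_mk, one_pow, mul_one, one_mul, ← ofAdd_nsmul, smul_eq_mul,
    Multiplicative.ofAdd.apply_eq_iff_eq] at hval
  obtain ⟨hval, rfl⟩ := hval
  obtain ⟨l, l', hl⟩ := XGroup.ofMonoid_eq_iff.1 hval
  congr 2
  have htype : type (ofX O m) = type (ofX O m') := by
    simpa [type_mul, type_pow] using hst
  -- As `m` and `m'` have the same type, the two multipliers also have equal types, and `z_g` counts
  -- `|G|` times in its class.
  have hperm : (l.map index).Perm (l'.map index) := by
    rw [List.perm_iff_count]
    intro i
    have := congrFun (congrArg (fun m => type (ofX O m)) hl) i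
    simp only [map_mul, type_mul, Pi.add_apply, htype, type_ofX_zprod] at this
    exact Nat.eq_of_mul_eq_mul_left (Nat.card_pos (α := G)) (by omega)
  rw [← hL, pow_succ'] at hl ⊢
  have h1 : ∀ (l : List O.carrier) (u : XMonoid O),
      XMonoid.zprod l * (XMonoid.zAll O * XMonoid.zAll O ^ K * u) =
        XMonoid.zAll O * XMonoid.zprod l * (XMonoid.zAll O ^ K * u) := fun l u => by
    rw [mul_assoc, ← mul_assoc, XMonoid.zprod_comm]
  rw [h1, h1, ← zAll_mul_zprod_eq hO hperm, ← h1, ← h1, ← pow_succ'] at hl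
  -- The common multiplier is now completed to a power of `zAll O`, which `hK` lowers to the `K`-th
  -- power.
  obtain ⟨w, n, hw⟩ := XMonoid.exists_mul_zprod_eq_pow l
  have h2 := congrArg (w * ·) hl
  simp only [← mul_assoc, hw, ← pow_add] at h2
  rw [mul_assoc, mul_assoc, hK _ _ ⟨_, h2⟩]

end Reduction

end StrongMonoid

end CoveringSemigroup

theorem mainTheorem7 {G : Type*} [Group G] [Finite G] (O : CoveringSemigroup.Equipment G)
    (hO : Subgroup.closure O.carrier = ⊤) :
    ∃ T : Fin O.m → ℕ, ∀ H : CoveringSemigroup.AdmissibleCollection,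
      Function.Bijective (CoveringSemigroup.restrictedQuotientHom H O T) := by
  open CoveringSemigroup in
  obtain ⟨T, hT⟩ := StrongMonoid.eq_of_value_eq hO
  -- The separation result asks for strict inequalities, whence the `+ 1`.
  refine ⟨fun i => T i + 1, fun H => ⟨?_, ?_⟩⟩
  · rintro ⟨s, hs⟩ ⟨t, ht⟩ h
    have h : quotientHom H O s = quotientHom H O t := congrArg Subtype.val h
    have htype : typ s = typ t := by rw [← typ_quotientHom (H := H), h, typ_quotientHom]
    refine Subtype.ext (WithOne.coe_injective (hT _ _ hs.1 ht.1 hs.2 htype ?_))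
    induction s using Con.induction_on
    induction t using Con.induction_on
    exact coveringCon_le_ker hO H ((Con.eq _).1 h)
  · rintro ⟨s, hs⟩
    induction s using Con.induction_on with
    | H w =>
      -- Type and generated subgroup are read off the word, so the same word represents a preimage
      -- in the required part.
      refine ⟨⟨(Con.toQuotient w : StrongCovering O), ?_⟩, rfl⟩
      exact hs
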